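/- **Setting.** Let $\mathcal G=(\mathcal V,\mathcal E)$ be a strongly connected directed graph on $n\ge 2$ agents, where $(i,j)\in\mathcal E$ means that $i$ can send messages to $j$. Let $\mathcal N_i^{\rm in}=\{j:(j,i)\in\mathcal E\}$, let $d_i=|\{j:(i,j)\in\mathcal E\}|$ be the out-degree, $d_{\max}=\max_i d_i$, $\phi$ the diameter, $A$ the matrix with $A_{ij}=1$ if $(j,i)\in\mathcal E$ and $A_{ij}=0$ otherwise, $D=\mathrm{diag}(d_1,\dots,d_n)$, $P=(I+AD^{-1})/2$, and $\lambda_2(P)$ the second largest modulus of the (complex) eigenvalues of $P$, counted with multiplicity. Let $f_i:\mathbb R^d\to\mathbb R$ ($i=1,\dots,n$) be differentiable with $(\nabla f_i(u)-\nabla f_i(v))^T(u-v)\ge m_f\|u-v\|^2$ and $\|\nabla f_i(u)-\nabla f_i(v)\|\le M_f\|u-v\|$ for all $u,v$, where $m_f,M_f>0$. Let $x^\star=(\hat x,\dots,\hat x)$ with $\hat x$ a minimizer of $\sum_i f_i$, and $y^\star_i=-\nabla f_i(\hat x)$. **Algorithm (IPD, all agents active).** Given $\eta,\rho>0$, an integer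 $B\ge1$, $x^0=y^0=z^0=0$ and initial weights $w_i^0(0)\in(0,d_{\max}^{-(2\phi+1)}]$ with $d_iw_i^0(0)<1$ for at least one $i$ (automatic when $d_{\max}\ge2$), for $k=0,1,\dots$ and every $i$: $x_i^{k+1}=x_i^k-\eta(\nabla f_i(x_i^k)+y_i^k+\rho(x_i^k-z_i^k))$; set $\xi_i^{k+1}(0)=x_i^{k+1}$; for $b=0,\dots,B-1$, $$w_i^k(b+1)=\tfrac12\Big(w_i^k(b)+\tfrac1{d_i}\sum_{j\in\mathcal N_i^{\rm in}}w_j^k(b)\Big),\qquad \xi_i^{k+1}(b+1)=(1-d_iw_i^k(b))\,\xi_i^{k+1}(b)+\sum_{j\in\mathcal N_i^{\rm in}}w_j^k(b)\,\xi_j^{k+1}(b);$$ then $w_i^{k+1}(0)=w_i^k(B)$, $z_i^{k+1}=\xi_i^{k+1}(B)$, $y_i^{k+1}=y_i^k+\rho(x_i^{k+1}-z_i^{k+1})$. **The parameter $\delta$.** Numbering the averaging rounds consecutively by $t=kB+b$, the weights $w(t)=w^k(b)$ depend only on $t$, $\mathcal G$ and the initial weights. Call $\delta\in(0,1)$ a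 contraction factor if for all sufficiently large $t$ the matrix $W(t)=I-(D-A)\,\mathrm{diag}(w(t))$ satisfies $\|W(t)v\|\le\delta\|v\|$ for all $v\in\mathbb R^n$ with $\mathbf 1^Tv=0$. **Theorem (Full Participation).** A contraction factor $\delta\in(0,1)$ exists. For every contraction factor $\delta$, all $f_i$ as above, and all $$0<\eta\le\frac{4}{15(M_f+m_f)},\qquad \rho\in\Big(0,\frac4{87}\frac{M_fm_f}{M_f+m_f}\Big),$$ $$B\ge\max\Big\{1,\ \tfrac12\Big(\frac{\ln\frac5{36}}{\ln\delta}+1\Big),\ \tfrac12\Big(\frac{\ln\frac{8M_fm_f}{9(M_f+m_f)^2}}{\ln\delta}+1\Big)\Big\},$$ the sequence generated by IPD with all agents active satisfies $$\|x^k-x^\star\|^2+\|y^k-y^\star\|^2=\mathcal O(\lambda^k),\qquad \lambda=\max\Big\{\frac{2\mu_1}{1+\mu_1},\lambda_2(P)\Big\},$$ where $\mu_1=\max\{\frac{c_1+c_2}{2c_2},\,1-\frac23\rho c_3\}$, $c_1=\frac1{2\eta}+2\rho+3\rho\delta^{2B-1}-\frac{m_fM_f}{m_f+M_f}$, $c_2=\frac1{2\eta}-\delta^{2B-1}\big[\frac{5\rho}4+\frac1\eta+\frac{3(m_f+M_f)}4\big]-\rho$,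 $c_3=\min\big\{\frac1{3(m_f+M_f)},\ \eta^2\big(\frac{3(m_f+M_f)}{16}-\rho\big),\ \frac{c_2-c_1}{\rho^2(4+4\delta^{2B-1})}\big\}$. -/

import Mathlib

open scoped Topology

noncomputable section

namespace IPD

variable {V : Type*} [Fintype V] [DecidableEq V]

/-! Directed communication graph: `G.Adj i j` means that `i` can send messages to `j`. -/

/-- Every node can be reached from every node along directed edges. -/
def StronglyConnected (G : Digraph V) : Prop :=
  ∀ i j, Relation.ReflTransGen G.Adj i j

open Classical in
/-- The in-neighbours `{j : (j, i) is an edge}`. -/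
def inNbrs (G : Digraph V) (i : V) : Finset V :=
  Finset.univ.filter fun j => G.Adj j i

open Classical in
/-- The out-degree `|{j : (i, j) is an edge}|`. -/
def outDeg (G : Digraph V) (i : V) : ℕ :=
  (Finset.univ.filter fun j => G.Adj i j).card

/-- The maximum out-degree. -/
def maxOutDeg (G : Digraph V) : ℕ :=
  Finset.univ.sup fun i => outDeg G i

/-- `Within G t i j`: there is a directed path from `i` to `j` with at most `t` edges. -/
def Within (G : Digraph V) : ℕ → V → V → Prop
  | 0, i, j => i = j
  | t + 1, i, j => ∃ l, Within G t i l ∧ (l = j ∨ G.Adj l j)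

/-- The diameter: the least `t` such that any node is reached from any node within `t` edges. -/
def diam (G : Digraph V) : ℕ :=
  sInf {t | ∀ i j, Within G t i j}

open Classical in
/-- The adjacency matrix, with `A i j = 1` exactly when `(j, i)` is an edge. -/
def adjMatrix (G : Digraph V) : Matrix V V ℝ :=
  Matrix.of fun i j => if G.Adj j i then 1 else 0

/-- The diagonal matrix of out-degrees. -/
def degMatrix (G : Digraph V) : Matrix V V ℝ :=
  Matrix.diagonal fun i => (outDeg G i : ℝ)

/-- `P = (I + A D⁻¹) / 2`. -/
def matP (G : Digraph V) : Matrix V V ℝ :=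
  (1 / 2 : ℝ) • (1 + adjMatrix G * (degMatrix G)⁻¹)

open Classical in
/-- The second largest modulus of the complex eigenvalues of `P`, counted with multiplicity.
`P` is column stochastic, so its largest eigenvalue in modulus is `1`; one copy of it is
removed and the largest of the remaining moduli is taken. -/
def lambda2 (G : Digraph V) : ℝ :=
  (((((matP G).map (fun r : ℝ => (r : ℂ))).charpoly.roots.erase 1).map fun z => ‖z‖₊).sup : NNReal)

section Algorithm

variable {E : Type*} [NormedAddCommGroup E] [InnerProductSpace ℝ E]

/-- One round of weight balancing,
`w_i ← (w_i + d_i⁻¹ ∑_{j in-neighbour of i} w_j) / 2`. -/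
def weightStep (G : Digraph V) (w : V → ℝ) : V → ℝ :=
  fun i => (1 / 2) * (w i + (1 / (outDeg G i : ℝ)) * ∑ j ∈ inNbrs G i, w j)

/-- One round of averaging with weights `w`,
`ξ_i ← (1 - d_i w_i) ξ_i + ∑_{j in-neighbour of i} w_j ξ_j`. -/
def avgStep (G : Digraph V) (w : V → ℝ) (ξ : V → E) : V → E :=
  fun i => (1 - (outDeg G i : ℝ) * w i) • ξ i + ∑ j ∈ inNbrs G i, w j • ξ j

/-- One pass of the inner loop: the weights and the averaged variables are updated
simultaneously, both from the current weights. -/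
def innerStep (G : Digraph V) (s : (V → ℝ) × (V → E)) : (V → ℝ) × (V → E) :=
  (weightStep G s.1, avgStep G s.1 s.2)

variable (V E) in
/-- The variables held by the agents at the start of an outer iteration. -/
structure State where
  x : V → E
  y : V → E
  z : V → E
  w : V → ℝ

variable [CompleteSpace E]

/-- The primal update: one gradient step on the local augmented Lagrangian. -/
def primalStep (f : V → E → ℝ) (η ρ : ℝ) (s : State V E) : V → E :=
  fun i => s.x i - η • (gradient (f i) (s.x i) + s.y i + ρ • (s.x i - s.z i))

/-- One outer iteration of IPD in which every agent is active. -/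
def step (G : Digraph V) (f : V → E → ℝ) (η ρ : ℝ) (B : ℕ) (s : State V E) : State V E :=
  let x' := primalStep f η ρ s
  let r := (innerStep G)^[B] (s.w, x')
  { x := x'
    y := fun i => s.y i + ρ • (x' i - r.2 i)
    z := r.2
    w := r.1 }

/-- The sequence generated by IPD with full participation from `x⁰ = y⁰ = z⁰ = 0` and
initial weights `w₀`. -/
def iterate (G : Digraph V) (f : V → E → ℝ) (η ρ : ℝ) (B : ℕ) (w₀ : V → ℝ) : ℕ → State V E
  | 0 => { x := 0, y := 0, z := 0, w := w₀ }
  | k + 1 => step G f η ρ B (iterate G f η ρ B w₀ k)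

/-- `(x⋆, y⋆)` is the primal-dual optimal pair of
`minimize ∑ f_i (x_i)` subject to `x_1 = ⋯ = x_n`: the common value of the blocks of `x⋆`
minimizes `∑ f_i`, and `∇ f_i (x⋆_i) + y⋆_i = 0` for all `i`. -/
def IsPrimalDualOptimal (f : V → E → ℝ) (xs ys : V → E) : Prop :=
  (∀ i j, xs i = xs j) ∧ (∀ u : E, ∑ i, f i (xs i) ≤ ∑ i, f i u) ∧
    ∀ i, gradient (f i) (xs i) + ys i = 0

end Algorithm

/-- `δ ∈ (0,1)` is an asymptotic contraction factor of the averaging rounds started from the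
weights `w₀`: from some round on, each round contracts the Euclidean norm of every vector with
zero sum by the factor `δ`. The weights in round `t` (counted over all outer iterations) are
`weightStep^[t] w₀`, whatever the number of rounds per outer iteration. -/
def IsContractionFactor (G : Digraph V) (w₀ : V → ℝ) (δ : ℝ) : Prop :=
  0 < δ ∧ δ < 1 ∧ ∃ t₀ : ℕ, ∀ t ≥ t₀, ∀ v : V → ℝ, ∑ i, v i = 0 →
    Real.sqrt (∑ i, avgStep G ((weightStep G)^[t] w₀) v i ^ 2) ≤ δ * Real.sqrt (∑ i, v i ^ 2)

/-! The constants of the rate; `m`, `M` are the strong convexity and Lipschitz constants. They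
are used only with `1 ≤ B`. -/

def c₁ (m M η ρ δ : ℝ) (B : ℕ) : ℝ :=
  1 / (2 * η) + 2 * ρ + 3 * ρ * δ ^ (2 * B - 1) - m * M / (m + M)

def c₂ (m M η ρ δ : ℝ) (B : ℕ) : ℝ :=
  1 / (2 * η) - δ ^ (2 * B - 1) * (5 * ρ / 4 + 1 / η + 3 * (m + M) / 4) - ρ

def c₃ (m M η ρ δ : ℝ) (B : ℕ) : ℝ :=
  min (1 / (3 * (m + M)))
    (min (η ^ 2 * (3 * (m + M) / 16 - ρ))
      ((c₂ m M η ρ δ B - c₁ m M η ρ δ B) / (ρ ^ 2 * (4 + 4 * δ ^ (2 * B - 1)))))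

def μ₁ (m M η ρ δ : ℝ) (B : ℕ) : ℝ :=
  max ((c₁ m M η ρ δ B + c₂ m M η ρ δ B) / (2 * c₂ m M η ρ δ B))
    (1 - 2 / 3 * ρ * c₃ m M η ρ δ B)

/-- `λ = max {2 μ₁ / (1 + μ₁), λ₂(P)}`. -/
def rate (G : Digraph V) (m M η ρ δ : ℝ) (B : ℕ) : ℝ :=
  max (2 * μ₁ m M η ρ δ B / (1 + μ₁ m M η ρ δ B)) (lambda2 G)

/-- The lower bound required of the number `B` of averaging rounds. -/
def minRounds (m M δ : ℝ) : ℝ :=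
  max 1 (max (1 / 2 * (Real.log (5 / 36) / Real.log δ + 1))
    (1 / 2 * (Real.log (8 * M * m / (9 * (M + m) ^ 2)) / Real.log δ + 1)))

end IPD

end

/-! Write `X = x - x⋆`, `Y = y - y⋆`, and let `R = z - mean x` be the error of the averaging rounds.
If `R` vanished, IPD would be a primal-dual gradient method on the consensus constraint, and strong
convexity with smoothness would make `c₂ ‖X‖² + ‖Y‖² / (2ρ)` contract. Sums are preserved by
averaging, so `y` keeps zero sum; `y⋆` has zero sum by optimality. Hence `Y` is orthogonal to
consensus vectors and its coupling with `X` cancels between the primal and the dual update, up to a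
term in `R` (`descent`). This gives a decrease in `X` only; reading `Y` off the primal update
(`dual_bound`) turns part of it into a decrease in `Y`, which yields the factor `μ₁`
(`lyapunov_step`).

The error `R` has two sources. The disagreement of `x` shrinks by `δ ^ B`; Young's inequality turns
this into a `δ ^ (2B - 1)` share of `‖X‖²`, absorbed by `c₁` and `c₂`. Moreover, unbalanced weights
do not fix consensus vectors, and the imbalance at a node is a multiple of the weight increment
there. In the variables `d_i w_i` balancing is multiplication by `P`, so the increments are `P ^ t
(P - 1) u₀`. By Cayley–Hamilton the factor `P - 1` removes one eigenvalue `1`, hence they decay at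
every rate above `λ₂(P)` (`weight_increment_le`).

The Lyapunov function thus satisfies `V (k+1) ≤ μ V k + C s ^ (2k)`, solved by `recursion_bound`. If
the claimed rate `r` is below `1`, take `s = √r > λ₂(P)`; the gap `μ₁ < 2 μ₁ / (1 + μ₁)` absorbs the
forcing term. A very small `η` can give `c₂ ≤ c₁`; then `r ≥ 1`, and `r` still dominates the
possible growth factor `c₁ / c₂`.

A contraction factor exists because the weights converge to balanced ones with `d_i w_i < 1`, whose
averaging matrix is doubly stochastic with positive diagonal and hence contracts zero-sum vectors
strictly; a small perturbation keeps this. -/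

noncomputable section

set_option linter.unusedSectionVars false

namespace IPD

/-! ### Inequalities for strongly monotone, Lipschitz gradients. -/

section Gradient

variable {E : Type*} [NormedAddCommGroup E] [InnerProductSpace ℝ E] [CompleteSpace E]

/-- A gradient that is `c`-strongly monotone gives the quadratic lower bound. -/
theorem quadratic_lower_bound {f : E → ℝ} {c : ℝ} {g : E → E}
    (hf : ∀ x, HasGradientAt f (g x) x)
    (hc : ∀ u v, c * ‖u - v‖ ^ 2 ≤ inner ℝ (g u - g v) (u - v)) (x y : E) :
    f x + inner ℝ (g x) (y - x) + c / 2 * ‖y - x‖ ^ 2 ≤ f y := by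
  set d := y - x with hd
  let φ : ℝ → ℝ := fun t => f (x + t • d) - t * inner ℝ (g x) d - c / 2 * t ^ 2 * ‖d‖ ^ 2
  have hder : ∀ t, HasDerivAt φ (inner ℝ (g (x + t • d)) d - inner ℝ (g x) d
      - c * t * ‖d‖ ^ 2) t := by
    intro t
    have h1 : HasDerivAt (fun t : ℝ => x + t • d) d t := by
      simpa using ((hasDerivAt_id t).smul_const d).const_add x
    have h2 : HasDerivAt (fun t : ℝ => f (x + t • d)) (inner ℝ (g (x + t • d)) d) t := by
      have := (hf (x + t • d)).hasFDerivAt.comp_hasDerivAt t h1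
      simpa [Function.comp_def] using this
    have h3 : HasDerivAt (fun t : ℝ => t * inner ℝ (g x) d) (inner ℝ (g x) d) t := by
      simpa using (hasDerivAt_id t).mul_const (inner ℝ (g x) d)
    have h4 : HasDerivAt (fun t : ℝ => c / 2 * t ^ 2 * ‖d‖ ^ 2) (c * t * ‖d‖ ^ 2) t := by
      have := (((hasDerivAt_id t).pow 2).const_mul (c / 2)).mul_const (‖d‖ ^ 2)
      refine this.congr_deriv ?_
      simp only [id]; norm_num; left; ring
    exact (h2.sub h3).sub h4
  have hmono : MonotoneOn φ (Set.Icc 0 1) := by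
    refine monotoneOn_of_deriv_nonneg (convex_Icc 0 1)
      (fun t _ => (hder t).continuousAt.continuousWithinAt)
      (fun t _ => (hder t).differentiableAt.differentiableWithinAt) ?_
    intro t ht
    rw [interior_Icc] at ht
    rw [(hder t).deriv]
    have h := hc (x + t • d) x
    rw [add_sub_cancel_left, inner_smul_right, norm_smul, inner_sub_left, Real.norm_eq_abs,
      mul_pow, sq_abs] at h
    have ht0 := ht.1
    have : 0 ≤ t * (inner ℝ (g (x + t • d)) d - inner ℝ (g x) d - c * t * ‖d‖ ^ 2) := by
      nlinarith
    exact nonneg_of_mul_nonneg_right this ht0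
  have h01 := hmono (Set.left_mem_Icc.2 zero_le_one) (Set.right_mem_Icc.2 zero_le_one) zero_le_one
  simp only [φ, zero_smul, add_zero, one_smul] at h01
  have : x + d = y := by simp [hd]
  rw [this] at h01
  linarith

/-- Strong monotonicity and Lipschitz continuity of a gradient combine to
`⟪∇f u - ∇f v, u - v⟫ ≥ (mM ‖u - v‖² + ‖∇f u - ∇f v‖²) / (m + M)`. -/
theorem inner_gradient_sub_ge {f : E → ℝ} {g : E → E} {m M : ℝ} (hm : 0 < m) (hM : 0 < M)
    (hf : ∀ x, HasGradientAt f (g x) x)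
    (hmono : ∀ u v, m * ‖u - v‖ ^ 2 ≤ inner ℝ (g u - g v) (u - v))
    (hlip : ∀ u v, ‖g u - g v‖ ≤ M * ‖u - v‖) (u v : E) :
    m * M / (m + M) * ‖u - v‖ ^ 2 + 1 / (m + M) * ‖g u - g v‖ ^ 2
      ≤ inner ℝ (g u - g v) (u - v) := by
  rcases eq_or_ne u v with rfl | huv
  · simp
  have hpos : 0 < ‖u - v‖ := norm_pos_iff.2 (sub_ne_zero.2 huv)
  have hup : ∀ a b, inner ℝ (g a - g b) (a - b) ≤ M * ‖a - b‖ ^ 2 := fun a b => by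
    have := real_inner_le_norm (g a - g b) (a - b)
    nlinarith [hlip a b, norm_nonneg (a - b)]
  have hmM : m ≤ M := by
    have := (hmono u v).trans (hup u v)
    exact le_of_mul_le_mul_right this (by positivity)
  have hlow := quadratic_lower_bound hf hmono
  have hhigh : ∀ x y, f y ≤ f x + inner ℝ (g x) (y - x) + M / 2 * ‖y - x‖ ^ 2 := by
    intro x y
    -- The lower bound has no sign condition on `c`: applied to `-f` with `c = -M` it is the descent
    -- lemma.
    have := quadratic_lower_bound (f := fun x => -f x) (g := fun x => -g x) (c := -M)
      (fun x => by
        have := (hf x).hasFDerivAt.neg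
        rw [hasGradientAt_iff_hasFDerivAt, map_neg]
        exact this)
      (fun a b => by
        have := hup a b
        have e : -g a - -g b = -(g a - g b) := by abel
        rw [e, inner_neg_left]
        linarith) x y
    simp only [inner_neg_left] at this
    linarith
  set X := u - v with hX
  set G := g u - g v with hG
  -- Co-coercivity of the gradient of the convex function `f - m/2 ‖·‖²`, which is `L`-smooth.
  -- Positive `L` allows division even when `M = m`; the value `L = M - m` is reached as a limit.
  have key : ∀ L, 0 < L → M - m ≤ L → ‖G - m • X‖ ^ 2 ≤ L * inner ℝ (G - m • X) X := by
    intro L hL hML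
    have half : ∀ a b : E, f a - f b - inner ℝ (g b) (a - b) - m / 2 * ‖a - b‖ ^ 2
        ≥ 1 / (2 * L) * ‖(g a - g b) - m • (a - b)‖ ^ 2 := by
      intro a b
      set p := (g a - g b) - m • (a - b) with hp
      -- The test point is a gradient step of length `1 / L` from `a` for `f - m/2 ‖· - b‖²` minus
      -- its linearization at `b`.
      have h1 := hlow b (a - L⁻¹ • p)
      have h2 := hhigh a (a - L⁻¹ • p)
      have e1 : a - L⁻¹ • p - b = (a - b) - L⁻¹ • p := by abel
      have e2 : a - L⁻¹ • p - a = -(L⁻¹ • p) := by abel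
      rw [e1] at h1
      rw [e2] at h2
      have hga : g a = g b + p + m • (a - b) := by rw [hp]; abel
      rw [hga] at h2
      set D := a - b
      rw [norm_sub_sq_real, norm_smul] at h1
      rw [norm_neg, norm_smul] at h2
      simp only [inner_neg_right, inner_sub_right, inner_smul_right, inner_add_left,
        inner_smul_left, real_inner_self_eq_norm_sq, Real.norm_eq_abs, mul_pow, sq_abs] at h1 h2
      simp only [conj_trivial] at h1 h2
      have hL' : L⁻¹ * L = 1 := inv_mul_cancel₀ hL.ne'
      have h3 : (M - m) * (L⁻¹ ^ 2 * ‖p‖ ^ 2) ≤ L⁻¹ * ‖p‖ ^ 2 := by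
        calc _ ≤ L * (L⁻¹ ^ 2 * ‖p‖ ^ 2) := by gcongr
          _ = (L⁻¹ * L) * (L⁻¹ * ‖p‖ ^ 2) := by ring
          _ = _ := by rw [hL', one_mul]
      have e3 : 1 / (2 * L) * ‖p‖ ^ 2 = 1 / 2 * (L⁻¹ * ‖p‖ ^ 2) := by field_simp
      rw [e3]
      nlinarith
    have h1 := half u v
    have h2 := half v u
    have e1 : v - u = -X := by rw [hX]; abel
    have e2 : g v - g u - m • (v - u) = -(G - m • X) := by
      rw [e1, smul_neg, hG]; abel
    rw [e2, norm_neg, e1, norm_neg, inner_neg_right] at h2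
    have h3 : 1 / L * ‖G - m • X‖ ^ 2 ≤ inner ℝ (G - m • X) X := by
      rw [inner_sub_left, inner_smul_left, real_inner_self_eq_norm_sq]
      have : inner ℝ G X = inner ℝ (g u) X - inner ℝ (g v) X := by rw [hG, inner_sub_left]
      have e4 : 1 / L * ‖G - m • X‖ ^ 2 = 2 * (1 / (2 * L) * ‖G - m • X‖ ^ 2) := by field_simp
      rw [this, e4]
      simp only [conj_trivial]
      linarith
    calc _ = L * (1 / L * ‖G - m • X‖ ^ 2) := by field_simp
      _ ≤ _ := by gcongr
  have hnn : 0 ≤ inner ℝ (G - m • X) X := by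
    have := hmono u v
    rw [inner_sub_left, inner_smul_left, real_inner_self_eq_norm_sq]
    simp only [conj_trivial]
    linarith
  have hlim : ‖G - m • X‖ ^ 2 ≤ (M - m) * inner ℝ (G - m • X) X := by
    have ht : Filter.Tendsto (fun e : ℝ => (M - m + e) * inner ℝ (G - m • X) X) (𝓝[>] 0)
        (𝓝 ((M - m + 0) * inner ℝ (G - m • X) X)) :=
      ((continuous_const.add continuous_id).mul continuous_const).continuousAt.tendsto.mono_left
        nhdsWithin_le_nhds
    rw [add_zero] at ht
    refine ge_of_tendsto ht ?_
    filter_upwards [self_mem_nhdsWithin] with e he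
    have he' : 0 < e := he
    exact key _ (by linarith) (by linarith)
  rw [norm_sub_sq_real, norm_smul, inner_sub_left G, inner_smul_right, inner_smul_left,
    real_inner_self_eq_norm_sq, Real.norm_eq_abs, mul_pow, sq_abs] at hlim
  simp only [conj_trivial] at hlim
  have hS : 0 < m + M := by linarith
  have e : m * M / (m + M) * ‖X‖ ^ 2 + 1 / (m + M) * ‖G‖ ^ 2
      = (m * M * ‖X‖ ^ 2 + ‖G‖ ^ 2) / (m + M) := by field_simp
  rw [e, div_le_iff₀ hS]
  nlinarith

end Gradient

/-! ### One primal-dual step in an abstract inner product space. -/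

section Descent

variable {H : Type*} [NormedAddCommGroup H] [InnerProductSpace ℝ H]

theorem inner_le_young (u v : H) {c : ℝ} (hc : 0 < c) :
    inner ℝ u v ≤ c * ‖u‖ ^ 2 + 1 / (4 * c) * ‖v‖ ^ 2 := by
  have h1 := real_inner_le_norm u v
  have h2 : c * ‖u‖ ^ 2 + 1 / (4 * c) * ‖v‖ ^ 2 - ‖u‖ * ‖v‖
      = (2 * c * ‖u‖ - ‖v‖) ^ 2 / (4 * c) := by field_simp; ring
  have h3 : 0 ≤ (2 * c * ‖u‖ - ‖v‖) ^ 2 / (4 * c) := by positivity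
  linarith

/-- One primal-dual step: `a`, `a'` are the disagreement parts of the primal errors `X`, `X'`,
`b'` is the consensus part of `X'`, and `R`, `R'` are the averaging errors. -/
theorem descent {X X' Y Y' g a a' b' R R' : H} {η ρ S p : ℝ} (hη : 0 < η) (hρ : 0 < ρ)
    (hS : 0 < S)
    (hX' : X' = X - η • (g + Y + ρ • (a - R)))
    (hY' : Y' = Y + ρ • (a' - R'))
    (hsplit : X' = a' + b')
    (hYb : inner ℝ Y b' = 0) (hab : inner ℝ a b' = 0) (hRb : inner ℝ R b' = 0)
    (hd : ‖a' - a‖ ≤ ‖X' - X‖)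
    (hg : p * ‖X‖ ^ 2 + 1 / S * ‖g‖ ^ 2 ≤ inner ℝ g X) :
    1 / (2 * η) * ‖X'‖ ^ 2 + 1 / (2 * ρ) * ‖Y'‖ ^ 2 ≤
      (1 / (2 * η) - p) * ‖X‖ ^ 2 + 1 / (2 * ρ) * ‖Y‖ ^ 2 - 1 / (3 * S) * ‖g‖ ^ 2
        - (1 / (4 * η) - 3 * S / 4 - ρ) * ‖X' - X‖ ^ 2
        + (1 / η + 3 * S / 4 + 2 * ρ) * ‖R'‖ ^ 2 + 2 * ρ * ‖R‖ ^ 2 := by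
  set d := X' - X with hdd
  have hdη : d = -(η • (g + Y + ρ • (a - R))) := by rw [hdd, hX']; abel
  have hY : Y = -(η⁻¹ • d) - g - ρ • (a - R) := by
    rw [hdη, smul_neg, smul_smul, inv_mul_cancel₀ hη.ne', one_smul]; abel
  have hXd : X = X' - d := by rw [hdd]; abel
  have e1 : ‖X‖ ^ 2 = ‖X'‖ ^ 2 - 2 * inner ℝ X' d + ‖d‖ ^ 2 := by
    rw [hXd, norm_sub_sq_real]
  have e2 : inner ℝ X' d
      = -(η * (inner ℝ g X' + inner ℝ Y X' + ρ * inner ℝ (a - R) X')) := by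
    rw [real_inner_comm, hdη, inner_neg_left, inner_smul_left, inner_add_left, inner_add_left,
      inner_smul_left]
    simp
  have e3 : ‖Y'‖ ^ 2 = ‖Y‖ ^ 2 + 2 * (ρ * inner ℝ Y (a' - R')) + ρ ^ 2 * ‖a' - R'‖ ^ 2 := by
    rw [hY', norm_add_sq_real, inner_smul_right, norm_smul, Real.norm_eq_abs, mul_pow, sq_abs]
  -- The term `⟪Y, a' - R'⟫` cancels against the cross term of `‖Y'‖²`. Only `⟪Y, R'⟫` is left, and
  -- `e6` expresses it through the primal update.
  have e4 : inner ℝ Y X' = inner ℝ Y (a' - R') + inner ℝ Y R' := by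
    rw [hsplit, inner_add_right, hYb, inner_sub_right]; ring
  have e5 : inner ℝ (a - R) X' = inner ℝ (a - R) (a' - R') + inner ℝ (a - R) R' := by
    rw [hsplit, inner_add_right, inner_sub_left a R b', hab, hRb, inner_sub_right]; ring
  have e6 : inner ℝ Y R' = -(η⁻¹ * inner ℝ d R') - inner ℝ g R' - ρ * inner ℝ (a - R) R' := by
    conv_lhs => rw [hY]
    rw [inner_sub_left, inner_sub_left, inner_neg_left, inner_smul_left, inner_smul_left]
    simp
  have e7 : inner ℝ g X' = inner ℝ g X + inner ℝ g d := by
    rw [← inner_add_right, hdd]; congr 1; abel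
  have e8 : ‖(a' - R') - (a - R)‖ ^ 2
      = ‖a' - R'‖ ^ 2 - 2 * inner ℝ (a - R) (a' - R') + ‖a - R‖ ^ 2 := by
    rw [norm_sub_sq_real, real_inner_comm]
  have y1 : inner ℝ d R' ≤ 1 / 4 * ‖d‖ ^ 2 + ‖R'‖ ^ 2 := by
    have := inner_le_young d R' (c := 1 / 4) (by norm_num)
    norm_num at this ⊢; linarith
  -- Of the `‖g‖² / S` supplied by `hg`, one third is spent here, one third in `y3`, and one third
  -- survives in the conclusion to pay for the dual error.
  have y2 : inner ℝ g R' ≤ 1 / (3 * S) * ‖g‖ ^ 2 + 3 * S / 4 * ‖R'‖ ^ 2 := by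
    have := inner_le_young g R' (c := 1 / (3 * S)) (by positivity)
    have e : 1 / (4 * (1 / (3 * S))) = 3 * S / 4 := by field_simp
    rwa [e] at this
  have y3 : -inner ℝ g d ≤ 1 / (3 * S) * ‖g‖ ^ 2 + 3 * S / 4 * ‖d‖ ^ 2 := by
    have := inner_le_young g (-d) (c := 1 / (3 * S)) (by positivity)
    have e : 1 / (4 * (1 / (3 * S))) = 3 * S / 4 := by field_simp
    rwa [e, inner_neg_right, norm_neg] at this
  have y4 : ‖(a' - R') - (a - R)‖ ^ 2 ≤ 2 * ‖d‖ ^ 2 + 4 * ‖R‖ ^ 2 + 4 * ‖R'‖ ^ 2 := by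
    have e : (a' - R') - (a - R) = (a' - a) + (R - R') := by abel
    rw [e]
    have h1 := norm_add_le (a' - a) (R - R')
    have h2 := norm_sub_le R R'
    have h3 : ‖(a' - a) + (R - R')‖ ≤ ‖d‖ + (‖R‖ + ‖R'‖) := by linarith
    calc _ ≤ (‖d‖ + (‖R‖ + ‖R'‖)) ^ 2 := by gcongr
      _ ≤ _ := by nlinarith [sq_nonneg (‖d‖ - (‖R‖ + ‖R'‖)), sq_nonneg (‖R‖ - ‖R'‖)]
  have y1' : η⁻¹ * inner ℝ d R' ≤ η⁻¹ * (1 / 4 * ‖d‖ ^ 2 + ‖R'‖ ^ 2) := by gcongr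
  have y4' : ρ / 2 * ‖(a' - R') - (a - R)‖ ^ 2
      ≤ ρ / 2 * (2 * ‖d‖ ^ 2 + 4 * ‖R‖ ^ 2 + 4 * ‖R'‖ ^ 2) := by gcongr
  have f1 : 1 / (2 * η) * ‖X'‖ ^ 2 - 1 / (2 * η) * ‖X‖ ^ 2 + 1 / (2 * η) * ‖d‖ ^ 2
      = -(inner ℝ g X' + inner ℝ Y X' + ρ * inner ℝ (a - R) X') := by
    rw [e1, e2]; field_simp; ring
  have f2 : 1 / (2 * ρ) * ‖Y'‖ ^ 2 - 1 / (2 * ρ) * ‖Y‖ ^ 2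
      = inner ℝ Y (a' - R') + ρ / 2 * ‖a' - R'‖ ^ 2 := by
    rw [e3]; field_simp; ring
  have s1 : 1 / (4 * η) = η⁻¹ / 4 := by field_simp
  have s2 : 1 / (2 * η) = η⁻¹ / 2 := by field_simp
  have s3 : 1 / η = η⁻¹ := by field_simp
  have s4 : 1 / S * ‖g‖ ^ 2 = 3 * (1 / (3 * S) * ‖g‖ ^ 2) := by field_simp
  have hq : 0 ≤ ρ / 2 * ‖a - R‖ ^ 2 := by positivity
  rw [e7, e4, e5, e6] at f1
  rw [s4] at hg
  rw [s1, s3]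
  rw [s2] at f1 ⊢
  have e8' : ρ / 2 * ‖(a' - R') - (a - R)‖ ^ 2
      = ρ / 2 * ‖a' - R'‖ ^ 2 - ρ * inner ℝ (a - R) (a' - R') + ρ / 2 * ‖a - R‖ ^ 2 := by
    rw [e8]; ring
  linarith

/-- The dual error is controlled by the primal increment, the gradient and the primal error. -/
theorem dual_bound {X X' Y g a R : H} {η ρ κ θ : ℝ} (hη : 0 < η)
    (hX' : X' = X - η • (g + Y + ρ • (a - R)))
    (ha : ‖a‖ ≤ ‖X‖) (hR : ‖R‖ ^ 2 ≤ κ * ‖X‖ ^ 2 + θ) :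
    ‖Y‖ ^ 2 ≤ 3 * (1 / η ^ 2 * ‖X' - X‖ ^ 2 + ‖g‖ ^ 2
      + ρ ^ 2 * ((2 + 2 * κ) * ‖X‖ ^ 2 + 2 * θ)) := by
  have hY : Y = -(η⁻¹ • (X' - X)) - g - ρ • (a - R) := by
    have hdη : X' - X = -(η • (g + Y + ρ • (a - R))) := by rw [hX']; abel
    rw [hdη, smul_neg, smul_smul, inv_mul_cancel₀ hη.ne', one_smul]; abel
  have h1 : ‖Y‖ ≤ ‖η⁻¹ • (X' - X)‖ + ‖g‖ + ‖ρ • (a - R)‖ := by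
    conv_lhs => rw [hY]
    refine (norm_sub_le _ _).trans ?_
    gcongr
    refine (norm_sub_le _ _).trans ?_
    rw [norm_neg]
  have h2 : ‖a - R‖ ^ 2 ≤ (2 + 2 * κ) * ‖X‖ ^ 2 + 2 * θ := by
    have h3 := norm_sub_le a R
    have h4 : ‖a - R‖ ^ 2 ≤ (‖a‖ + ‖R‖) ^ 2 := by gcongr
    have h5 : ‖a‖ ^ 2 ≤ ‖X‖ ^ 2 := by gcongr
    nlinarith [sq_nonneg (‖a‖ - ‖R‖)]
  have h6 : ‖η⁻¹ • (X' - X)‖ ^ 2 = 1 / η ^ 2 * ‖X' - X‖ ^ 2 := by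
    rw [norm_smul, mul_pow, Real.norm_eq_abs, sq_abs]; field_simp
  have h7 : ‖ρ • (a - R)‖ ^ 2 = ρ ^ 2 * ‖a - R‖ ^ 2 := by
    rw [norm_smul, mul_pow, Real.norm_eq_abs, sq_abs]
  have h8 : ρ ^ 2 * ‖a - R‖ ^ 2 ≤ ρ ^ 2 * ((2 + 2 * κ) * ‖X‖ ^ 2 + 2 * θ) := by gcongr
  have h9 : ‖Y‖ ^ 2 ≤ (‖η⁻¹ • (X' - X)‖ + ‖g‖ + ‖ρ • (a - R)‖) ^ 2 := by gcongr
  rw [← h6]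
  nlinarith [sq_nonneg (‖η⁻¹ • (X' - X)‖ - ‖g‖), sq_nonneg (‖η⁻¹ • (X' - X)‖ - ‖ρ • (a - R)‖),
    sq_nonneg (‖g‖ - ‖ρ • (a - R)‖)]

end Descent

/-! ### Signs and sizes of the constants. -/

section Constants

variable {m M η ρ δ : ℝ} {B : ℕ}

theorem harmonic_le (hm : 0 < m) (hM : 0 < M) : M * m / (M + m) ≤ (m + M) / 4 := by
  rw [div_le_iff₀ (by positivity)]
  nlinarith [sq_nonneg (M - m)]

theorem pow_le_of_minRounds (hδ : 0 < δ) (hδ1 : δ < 1) (hB : minRounds m M δ ≤ B) :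
    1 ≤ B ∧ δ ^ (2 * B - 1) ≤ 5 / 36 := by
  have h1 : (1 : ℝ) ≤ B := (le_max_left _ _).trans hB
  have h1' : 1 ≤ B := by exact_mod_cast h1
  have h2 : 1 / 2 * (Real.log (5 / 36) / Real.log δ + 1) ≤ B :=
    (le_max_left _ _).trans ((le_max_right _ _).trans hB)
  refine ⟨h1', ?_⟩
  have hl : Real.log δ < 0 := Real.log_neg hδ hδ1
  have h3 : Real.log (5 / 36) / Real.log δ ≤ ((2 * B - 1 : ℕ) : ℝ) := by
    rw [Nat.cast_sub (by omega)]
    push_cast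
    linarith
  rw [div_le_iff_of_neg hl, ← Real.log_pow] at h3
  exact (Real.log_le_log_iff (by positivity) (by norm_num)).1 h3

/-- The hypotheses of the convergence theorem on the constants. -/
structure Admissible (m M η ρ δ : ℝ) (B : ℕ) : Prop where
  m_pos : 0 < m
  M_pos : 0 < M
  η_pos : 0 < η
  η_le : η ≤ 4 / (15 * (M + m))
  ρ_pos : 0 < ρ
  ρ_lt : ρ < 4 / 87 * (M * m / (M + m))
  δ_pos : 0 < δ
  δ_lt : δ < 1
  one_le : 1 ≤ B
  pow_le : δ ^ (2 * B - 1) ≤ 5 / 36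

namespace Admissible

theorem rho_le (h : Admissible m M η ρ δ B) : ρ ≤ (m + M) / 87 := by
  have := harmonic_le h.m_pos h.M_pos
  linarith [h.ρ_lt]

theorem eta_inv_ge (h : Admissible m M η ρ δ B) : 15 / 4 * (m + M) ≤ 1 / η := by
  have hS : 0 < M + m := add_pos h.M_pos h.m_pos
  rw [le_div_iff₀ h.η_pos]
  have := h.η_le
  rw [le_div_iff₀ (by positivity)] at this
  linarith

/-- The slack `12 ρ (1 + δ ^ (2B - 1))` is what `c₁_div_c₂_le` needs when `c₂ ≤ c₁`. After the loss
of the share `5/36`, the term `1 / η ≥ 15/4 (m + M)` outweighs all others because `ρ ≤ (m + M) /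
87`. -/
theorem c₂_ge (h : Admissible m M η ρ δ B) :
    c₁ m M η ρ δ B + 12 * ρ * (1 + δ ^ (2 * B - 1)) ≤ 2 * c₂ m M η ρ δ B := by
  have h1 := h.rho_le
  have h2 := h.eta_inv_ge
  have h3 := h.pow_le
  have h4 := h.ρ_pos
  have hS : 0 < m + M := add_pos h.m_pos h.M_pos
  have hh : 0 ≤ m * M / (m + M) := div_nonneg (mul_pos h.m_pos h.M_pos).le hS.le
  have hκ : 0 < δ ^ (2 * B - 1) := pow_pos h.δ_pos _
  unfold c₁ c₂
  set κ := δ ^ (2 * B - 1)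
  have e : 1 / (2 * η) = 1 / η / 2 := by have := h.η_pos; field_simp
  rw [e]
  set e' := 1 / η
  have h5 : κ * e' ≤ 5 / 36 * e' := by
    have : 0 ≤ e' := by linarith
    gcongr
  have h6 : κ * (m + M) ≤ 5 / 36 * (m + M) := by gcongr
  have h7 : κ * ρ ≤ 5 / 36 * ρ := by gcongr
  linarith

theorem c₁_pos (h : Admissible m M η ρ δ B) : 0 < c₁ m M η ρ δ B := by
  have h2 := h.eta_inv_ge
  have hκ : 0 < δ ^ (2 * B - 1) := pow_pos h.δ_pos _
  have hρ := h.ρ_pos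
  have hh := harmonic_le h.M_pos h.m_pos
  have hS : 0 < m + M := add_pos h.m_pos h.M_pos
  have e : 1 / (2 * η) = 1 / η / 2 := by have := h.η_pos; field_simp
  unfold c₁
  rw [e]
  have : 0 < 3 * ρ * δ ^ (2 * B - 1) := by positivity
  linarith

theorem c₂_pos (h : Admissible m M η ρ δ B) : 0 < c₂ m M η ρ δ B := by
  have h1 := h.c₂_ge
  have h2 := h.c₁_pos
  have hκ : 0 < δ ^ (2 * B - 1) := pow_pos h.δ_pos _
  have hρ := h.ρ_pos
  have : 0 < 12 * ρ * (1 + δ ^ (2 * B - 1)) := by positivity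
  linarith

theorem μ₁_pos (h : Admissible m M η ρ δ B) : 0 < μ₁ m M η ρ δ B := by
  refine lt_of_lt_of_le ?_ (le_max_left _ _)
  have := h.c₁_pos
  have := h.c₂_pos
  positivity

theorem c₃_pos (h : Admissible m M η ρ δ B) (hc : c₁ m M η ρ δ B < c₂ m M η ρ δ B) :
    0 < c₃ m M η ρ δ B := by
  have hS : 0 < m + M := add_pos h.m_pos h.M_pos
  have h1 := h.rho_le
  have hκ : 0 < δ ^ (2 * B - 1) := pow_pos h.δ_pos _
  have hρ := h.ρ_pos
  have hη := h.η_pos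
  refine lt_min (by positivity) (lt_min ?_ ?_)
  · have : 0 < 3 * (m + M) / 16 - ρ := by linarith
    positivity
  · have : 0 < c₂ m M η ρ δ B - c₁ m M η ρ δ B := by linarith
    positivity

theorem μ₁_lt_one (h : Admissible m M η ρ δ B) (hc : c₁ m M η ρ δ B < c₂ m M η ρ δ B) :
    μ₁ m M η ρ δ B < 1 := by
  have h3 := h.c₃_pos hc
  have h2 := h.c₂_pos
  have hρ := h.ρ_pos
  refine max_lt ?_ ?_
  · rw [div_lt_one (by positivity)]; linarith
  · have : 0 < 2 / 3 * ρ * c₃ m M η ρ δ B := by positivity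
    linarith

/-- This strict gap is why the rate is `2 μ₁ / (1 + μ₁)` and not `μ₁`: it leaves room for a forcing
term that decays exactly at the claimed rate. -/
theorem μ₁_lt_of_lt_one (h : Admissible m M η ρ δ B) (hc : μ₁ m M η ρ δ B < 1) :
    μ₁ m M η ρ δ B < 2 * μ₁ m M η ρ δ B / (1 + μ₁ m M η ρ δ B) := by
  have := h.μ₁_pos
  rw [lt_div_iff₀ (by positivity)]
  nlinarith

/-- When the constants do not yield a contraction, the claimed rate still dominates the growth
factor `c₁ / c₂` of the Lyapunov function. -/
theorem c₁_div_c₂_le (h : Admissible m M η ρ δ B) (hc : c₂ m M η ρ δ B ≤ c₁ m M η ρ δ B) :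
    1 ≤ 2 * μ₁ m M η ρ δ B / (1 + μ₁ m M η ρ δ B) ∧
    c₁ m M η ρ δ B / c₂ m M η ρ δ B ≤ 2 * μ₁ m M η ρ δ B / (1 + μ₁ m M η ρ δ B) := by
  have hκ : 0 < δ ^ (2 * B - 1) := pow_pos h.δ_pos _
  have hρ := h.ρ_pos
  have hμ := h.μ₁_pos
  have h2 := h.c₂_pos
  have hge := h.c₂_ge
  set κ := δ ^ (2 * B - 1) with hκdef
  have h3 : c₃ m M η ρ δ B ≤ (c₂ m M η ρ δ B - c₁ m M η ρ δ B) / (ρ ^ 2 * (4 + 4 * κ)) :=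
    (min_le_right _ _).trans (min_le_right _ _)
  have h4 : 1 - 2 / 3 * ρ * c₃ m M η ρ δ B ≤ μ₁ m M η ρ δ B := le_max_right _ _
  set a := c₁ m M η ρ δ B
  set b := c₂ m M η ρ δ B
  set μ := μ₁ m M η ρ δ B
  -- When `c₂ ≤ c₁` the third entry of `c₃` is nonpositive, which pushes the second entry of `μ₁`
  -- above `1` in proportion to `c₁ - c₂`.
  have h5 : 1 + (a - b) / (6 * ρ * (1 + κ)) ≤ μ := by
    have e : 1 + (a - b) / (6 * ρ * (1 + κ)) = 1 - 2 / 3 * ρ * ((b - a) / (ρ ^ 2 * (4 + 4 * κ))) := by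
      have : (4 + 4 * κ) = 4 * (1 + κ) := by ring
      rw [this]
      field_simp
      ring
    rw [e]
    refine le_trans ?_ h4
    gcongr
  have h6 : 0 ≤ (a - b) / (6 * ρ * (1 + κ)) := by
    have : 0 ≤ a - b := by linarith
    positivity
  have h7 : (a - b) ≤ (μ - 1) * (6 * ρ * (1 + κ)) := by
    rw [← div_le_iff₀ (by positivity)]; linarith
  constructor
  · rw [le_div_iff₀ (by positivity)]; linarith
  -- The claim is `(μ - 1)(2b - a) ≥ 2(a - b)`. By `c₂_ge`, `2b - a ≥ 12 ρ (1 + κ)`, and `h7` bounds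
  -- `a - b` by half of that times `μ - 1`.
  · rw [div_le_div_iff₀ h2 (by positivity)]
    nlinarith

end Admissible

end Constants

/-! ### The Lyapunov inequality and perturbed linear recursions. -/

section Lyapunov

variable {H : Type*} [NormedAddCommGroup H] [InnerProductSpace ℝ H]

/-- The Lyapunov inequality before the dual error is used. -/
theorem descent_constants {m M η ρ δ : ℝ} {B : ℕ} (h : Admissible m M η ρ δ B)
    {x x' y y' g d r r' θ θ' : ℝ} (hx : 0 ≤ x) (hx' : 0 ≤ x') (hd : 0 ≤ d)
    (hdes : 1 / (2 * η) * x' + y' ≤ (1 / (2 * η) - m * M / (m + M)) * x + y - g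
        - (1 / (4 * η) - 3 * (m + M) / 4 - ρ) * d
        + (1 / η + 3 * (m + M) / 4 + 2 * ρ) * r' + 2 * ρ * r)
    (hr : r ≤ δ ^ (2 * B - 1) * x + θ) (hr' : r' ≤ δ ^ (2 * B - 1) * x' + θ') :
    c₂ m M η ρ δ B * x' + y' ≤ c₁ m M η ρ δ B * x + y - g
        - (3 * (m + M) / 16 - ρ) * d + (1 / η + 3 * (m + M) / 4 + 2 * ρ) * θ' + 2 * ρ * θ := by
  have hS : 0 < m + M := add_pos h.m_pos h.M_pos
  have hκ : 0 < δ ^ (2 * B - 1) := pow_pos h.δ_pos _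
  have hκ1 := h.pow_le
  have hρ := h.ρ_pos
  have hη := h.η_pos
  have hηi := h.eta_inv_ge
  have e4 : 1 / (4 * η) = 1 / η / 4 := by field_simp
  have hρκ : ρ * δ ^ (2 * B - 1) ≤ ρ * (5 / 36) := by gcongr
  have hρκ0 : 0 ≤ ρ * δ ^ (2 * B - 1) := by positivity
  -- The step size bound enters here: `1 / (4η) ≥ 15/16 (m + M) = (3/4 + 3/16)(m + M)`.
  have k3 : 3 * (m + M) / 16 - ρ ≤ 1 / (4 * η) - 3 * (m + M) / 4 - ρ := by
    rw [e4]; linarith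
  have k1 : c₂ m M η ρ δ B
      ≤ 1 / (2 * η) - (1 / η + 3 * (m + M) / 4 + 2 * ρ) * δ ^ (2 * B - 1) := by
    unfold c₂
    generalize 1 / η = e, 1 / (2 * η) = e', δ ^ (2 * B - 1) = κ at *
    linarith
  have k2 : 1 / (2 * η) - m * M / (m + M) + 2 * ρ * δ ^ (2 * B - 1) ≤ c₁ m M η ρ δ B := by
    unfold c₁
    linarith
  have hC : 0 < 1 / η + 3 * (m + M) / 4 + 2 * ρ := by positivity
  have r1 := mul_le_mul_of_nonneg_left hr' hC.le
  have r2 := mul_le_mul_of_nonneg_left hr (by positivity : 0 ≤ 2 * ρ)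
  have k1' := mul_le_mul_of_nonneg_right k1 hx'
  have k2' := mul_le_mul_of_nonneg_right k2 hx
  have k3' := mul_le_mul_of_nonneg_right k3 hd
  clear hr hr' k1 k2 k3 hκ hκ1 hρ hη hηi e4 hρκ hρκ0 hC hS h
  generalize 1 / η + 3 * (m + M) / 4 + 2 * ρ = C, 1 / (2 * η) = A, m * M / (m + M) = p,
    δ ^ (2 * B - 1) = κ, c₂ m M η ρ δ B = b, c₁ m M η ρ δ B = a,
    1 / (4 * η) - 3 * (m + M) / 4 - ρ = D, 3 * (m + M) / 16 - ρ = D' at *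
  linarith

/-- The Lyapunov inequality of one primal-dual step. -/
theorem lyapunov_step {m M η ρ δ : ℝ} {B : ℕ} (h : Admissible m M η ρ δ B) :
    ∃ C, 0 ≤ C ∧ ∀ {X X' Y Y' g a a' b' R R' : H} {θ θ' : ℝ}, 0 ≤ θ → 0 ≤ θ' →
    X' = X - η • (g + Y + ρ • (a - R)) → Y' = Y + ρ • (a' - R') → X' = a' + b' →
    inner ℝ Y b' = 0 → inner ℝ a b' = 0 → inner ℝ R b' = 0 →
    ‖a' - a‖ ≤ ‖X' - X‖ → ‖a‖ ≤ ‖X‖ →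
    m * M / (m + M) * ‖X‖ ^ 2 + 1 / (m + M) * ‖g‖ ^ 2 ≤ inner ℝ g X →
    ‖R‖ ^ 2 ≤ δ ^ (2 * B - 1) * ‖X‖ ^ 2 + θ →
    ‖R'‖ ^ 2 ≤ δ ^ (2 * B - 1) * ‖X'‖ ^ 2 + θ' →
    c₂ m M η ρ δ B * ‖X'‖ ^ 2 + 1 / (2 * ρ) * ‖Y'‖ ^ 2 ≤
      (if c₁ m M η ρ δ B < c₂ m M η ρ δ B then μ₁ m M η ρ δ B
        else c₁ m M η ρ δ B / c₂ m M η ρ δ B)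
        * (c₂ m M η ρ δ B * ‖X‖ ^ 2 + 1 / (2 * ρ) * ‖Y‖ ^ 2) + C * (θ + θ') := by
  have hS : 0 < m + M := add_pos h.m_pos h.M_pos
  have hκ : 0 < δ ^ (2 * B - 1) := pow_pos h.δ_pos _
  have hκ1 := h.pow_le
  have hρ := h.ρ_pos
  have hη := h.η_pos
  have hηi := h.eta_inv_ge
  have hc₂ := h.c₂_pos
  set C₁ := 1 / η + 3 * (m + M) / 4 + 2 * ρ with hC₁
  have hC₁0 : 0 ≤ C₁ := by positivity
  -- The absolute value keeps the error constant nonnegative before the sign of `c₃` is known.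
  set C₃ := 2 * ρ ^ 2 * |c₃ m M η ρ δ B| with hC₃
  have hC₃0 : 0 ≤ C₃ := by positivity
  refine ⟨C₁ + 2 * ρ + C₃, by positivity, ?_⟩
  intro X X' Y Y' g a a' b' R R' θ θ' hθ hθ' hX' hY' hsplit hYb hab hRb hd ha hg hR hR'
  have hdes := descent hη hρ hS hX' hY' hsplit hYb hab hRb hd hg
  have hdual := dual_bound hη hX' ha hR
  have hbase := descent_constants h (sq_nonneg ‖X‖) (sq_nonneg ‖X'‖) (sq_nonneg ‖X' - X‖)
    hdes hR hR'
  rw [← hC₁] at hbase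
  have hg0 : 0 ≤ 1 / (3 * (m + M)) * ‖g‖ ^ 2 := by positivity
  have hρS : 0 ≤ 3 * (m + M) / 16 - ρ := by linarith [h.rho_le]
  have hd0 : 0 ≤ (3 * (m + M) / 16 - ρ) * ‖X' - X‖ ^ 2 := by positivity
  split_ifs with hc
  · have h3 := h.c₃_pos hc
    have u1 : c₃ m M η ρ δ B ≤ 1 / (3 * (m + M)) := min_le_left _ _
    have u2 : c₃ m M η ρ δ B ≤ η ^ 2 * (3 * (m + M) / 16 - ρ) :=
      (min_le_right _ _).trans (min_le_left _ _)
    have u3 : c₃ m M η ρ δ B ≤ (c₂ m M η ρ δ B - c₁ m M η ρ δ B)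
        / (ρ ^ 2 * (4 + 4 * δ ^ (2 * B - 1))) := (min_le_right _ _).trans (min_le_right _ _)
    have m1 : (c₁ m M η ρ δ B + c₂ m M η ρ δ B) / (2 * c₂ m M η ρ δ B) ≤ μ₁ m M η ρ δ B :=
      le_max_left _ _
    have m2 : 1 - 2 / 3 * ρ * c₃ m M η ρ δ B ≤ μ₁ m M η ρ δ B := le_max_right _ _
    rw [le_div_iff₀ (by positivity)] at u3
    rw [div_le_iff₀ (by positivity)] at m1
    have habs : |c₃ m M η ρ δ B| = c₃ m M η ρ δ B := abs_of_pos h3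
    rw [habs] at hC₃
    set c := c₃ m M η ρ δ B
    set κ := δ ^ (2 * B - 1)
    -- The three entries of `c₃` make the three terms of `dual_bound`, scaled by `c / 3`,
    -- affordable. The `‖X‖²` term costs only half of `c₂ - c₁`, which leaves the coefficient `(c₁ +
    -- c₂) / 2`.
    have v1 : c * ‖g‖ ^ 2 ≤ 1 / (3 * (m + M)) * ‖g‖ ^ 2 := by gcongr
    have v2 : c * (1 / η ^ 2) * ‖X' - X‖ ^ 2 ≤ (3 * (m + M) / 16 - ρ) * ‖X' - X‖ ^ 2 := by
      have : c * (1 / η ^ 2) ≤ 3 * (m + M) / 16 - ρ := by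
        rw [mul_one_div, div_le_iff₀ (by positivity)]; linarith
      gcongr
    have v3 : c * (ρ ^ 2 * (4 + 4 * κ)) * ‖X‖ ^ 2
        ≤ (c₂ m M η ρ δ B - c₁ m M η ρ δ B) * ‖X‖ ^ 2 := by gcongr
    have v4 : c / 3 * ‖Y‖ ^ 2 ≤ c / 3 * (3 * (1 / η ^ 2 * ‖X' - X‖ ^ 2 + ‖g‖ ^ 2
      + ρ ^ 2 * ((2 + 2 * κ) * ‖X‖ ^ 2 + 2 * θ))) := by gcongr
    have w1 := mul_le_mul_of_nonneg_right m1 (sq_nonneg ‖X‖)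
    have w2 : (1 - 2 / 3 * ρ * c) * (1 / (2 * ρ) * ‖Y‖ ^ 2)
        ≤ μ₁ m M η ρ δ B * (1 / (2 * ρ) * ‖Y‖ ^ 2) := by gcongr
    have w3 : (1 - 2 / 3 * ρ * c) * (1 / (2 * ρ) * ‖Y‖ ^ 2)
        = 1 / (2 * ρ) * ‖Y‖ ^ 2 - c / 3 * ‖Y‖ ^ 2 := by field_simp
    have t1 : 0 ≤ C₁ * θ := by positivity
    have t2 : 0 ≤ 2 * ρ * θ' := by positivity
    have t3 : 0 ≤ C₃ * θ' := by positivity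
    have t4 : C₃ * θ = 2 * ρ ^ 2 * c * θ := by rw [hC₃]
    linarith
  · have hc' := not_lt.1 hc
    -- No contraction is available here: the negative terms are dropped, and a factor of at least
    -- `1` covers the `Y` part.
    have n1 : 1 ≤ c₁ m M η ρ δ B / c₂ m M η ρ δ B := by rwa [le_div_iff₀ hc₂, one_mul]
    have n2 : 1 * (1 / (2 * ρ) * ‖Y‖ ^ 2)
      ≤ c₁ m M η ρ δ B / c₂ m M η ρ δ B * (1 / (2 * ρ) * ‖Y‖ ^ 2) := by gcongr
    have n3 : c₁ m M η ρ δ B / c₂ m M η ρ δ B * (c₂ m M η ρ δ B * ‖X‖ ^ 2)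
      = c₁ m M η ρ δ B * ‖X‖ ^ 2 := by field_simp
    have t1 : 0 ≤ C₁ * θ := by positivity
    have t2 : 0 ≤ 2 * ρ * θ' := by positivity
    have t3 : 0 ≤ C₃ * (θ + θ') := by positivity
    linarith

/-- A perturbed linear recursion is `O(r ^ k)`. -/
theorem recursion_bound {V : ℕ → ℝ} {μ r p C : ℝ} (hμ : 0 ≤ μ) (hr : 0 < r) (hp : 0 ≤ p)
    (hC : 0 ≤ C) (h : (μ < r ∧ p ≤ r) ∨ (μ ≤ r ∧ p < r)) (K : ℕ)
    (hV0 : ∀ k, 0 ≤ V k) (hV : ∀ k ≥ K, V (k + 1) ≤ μ * V k + C * p ^ k) :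
    ∃ D, 0 ≤ D ∧ ∀ k ≥ K, V k ≤ D * r ^ k := by
  rcases h with ⟨hμr, hpr⟩ | ⟨hμr, hpr⟩
  · have hgap : 0 < r - μ := by linarith
    set D := max (V K / r ^ K) (C / (r - μ)) with hD
    have hD2 : C ≤ D * (r - μ) := by
      rw [← div_le_iff₀ hgap]; exact le_max_right _ _
    refine ⟨D, le_trans (by positivity) (le_max_right _ _), ?_⟩
    intro k hk
    induction k, hk using Nat.le_induction with
    | base => rw [← div_le_iff₀ (by positivity)]; exact le_max_left _ _
    | succ k hk ih =>
      have h1 := hV k hk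
      have h2 : p ^ k ≤ r ^ k := by gcongr
      have h3 : C * p ^ k ≤ D * (r - μ) * r ^ k := by
        have := hC.trans hD2
        gcongr
      have h4 : μ * V k ≤ μ * (D * r ^ k) := by gcongr
      calc _ ≤ _ := h1
        _ ≤ μ * (D * r ^ k) + D * (r - μ) * r ^ k := by linarith
        _ = _ := by ring
  -- With `c = C / (r - p)` the sum `V k + c p ^ k` grows by at most the factor `r`, so `μ = r` is
  -- allowed.
  · have hgap : 0 < r - p := by linarith
    set c := C / (r - p) with hc
    have hc0 : 0 ≤ c := by positivity
    have hcC : c * (r - p) = C := by rw [hc]; field_simp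
    set D := max ((V K + c * p ^ K) / r ^ K) 0
    have hD0 : 0 ≤ D := le_max_right _ _
    refine ⟨D, hD0, ?_⟩
    have key : ∀ k ≥ K, V k + c * p ^ k ≤ D * r ^ k := by
      intro k hk
      induction k, hk using Nat.le_induction with
      | base => rw [← div_le_iff₀ (by positivity)]; exact le_max_left _ _
      | succ k hk ih =>
        have h1 := hV k hk
        have h2 : μ * V k ≤ r * V k := mul_le_mul_of_nonneg_right hμr (hV0 k)
        calc V (k + 1) + c * p ^ (k + 1) ≤ r * V k + c * (r - p) * p ^ k + c * p ^ (k + 1) := by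
              rw [hcC]; linarith
          _ = r * (V k + c * p ^ k) := by ring
          _ ≤ r * (D * r ^ k) := by gcongr
          _ = _ := by ring
    intro k hk
    have := key k hk
    have : 0 ≤ c * p ^ k := by positivity
    linarith

end Lyapunov

variable {V : Type*} [Fintype V] [DecidableEq V]

/-! ### Degrees, paths and the diameter. -/

section Graph

variable {G : Digraph V}

theorem mem_inNbrs {i j : V} : j ∈ inNbrs G i ↔ G.Adj j i := by
  simp [inNbrs]

theorem outDeg_pos [Nontrivial V] (hG : StronglyConnected G) (i : V) : 0 < outDeg G i := by
  obtain ⟨j, hj⟩ := exists_ne i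
  rcases Relation.ReflTransGen.cases_head (hG i j) with h | ⟨l, hl, -⟩
  · exact absurd h.symm hj
  · exact Finset.card_pos.2 ⟨l, by simpa using hl⟩

theorem outDeg_le_maxOutDeg (i : V) : outDeg G i ≤ maxOutDeg G :=
  Finset.le_sup (f := fun i => outDeg G i) (Finset.mem_univ i)

theorem outDeg_le_card (i : V) : outDeg G i ≤ Fintype.card V := by
  classical
  exact Finset.card_le_univ _

/-- Summing a function of the sender over all edges. -/
theorem sum_sum_inNbrs {F : Type*} [AddCommGroup F] [Module ℝ F] (g : V → F) :
    ∑ i, ∑ j ∈ inNbrs G i, g j = ∑ j, (outDeg G j : ℝ) • g j := by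
  classical
  simp only [inNbrs, Finset.sum_filter]
  rw [Finset.sum_comm]
  refine Finset.sum_congr rfl fun j _ => ?_
  rw [← Finset.sum_filter, Finset.sum_const, outDeg, Nat.cast_smul_eq_nsmul]

theorem forall_eq_of_adj {α : Type*} (hG : StronglyConnected G) {v : V → α}
    (h : ∀ i j, G.Adj j i → v j = v i) (i j : V) : v i = v j := by
  induction hG i j with
  | refl => rfl
  | tail _ hl ih => exact ih.trans (h _ _ hl)

theorem Within.mono {s t : ℕ} (hst : s ≤ t) {i j : V} (h : Within G s i j) : Within G t i j := by
  induction t, hst using Nat.le_induction with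
  | base => exact h
  | succ t _ ih => exact ⟨j, ih, Or.inl rfl⟩

theorem exists_within (hG : StronglyConnected G) (i j : V) : ∃ t, Within G t i j := by
  induction hG i j with
  | refl => exact ⟨0, rfl⟩
  | tail _ hl ih =>
    obtain ⟨t, ht⟩ := ih
    exact ⟨t + 1, _, ht, Or.inr hl⟩

theorem within_diam (hG : StronglyConnected G) (i j : V) : Within G (diam G) i j := by
  have hne : {t | ∀ i j, Within G t i j}.Nonempty := by
    choose t ht using exists_within hG
    refine ⟨Finset.univ.sup fun p : V × V => t p.1 p.2, fun i j => (ht i j).mono ?_⟩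
    exact Finset.le_sup (f := fun p : V × V => t p.1 p.2) (Finset.mem_univ (i, j))
  exact Nat.sInf_mem hne i j

theorem diam_pos [Nontrivial V] (hG : StronglyConnected G) : 0 < diam G := by
  obtain ⟨i, j, hij⟩ := exists_pair_ne V
  by_contra h
  have := within_diam hG i j
  rw [Nat.eq_zero_of_not_pos h] at this
  exact hij this

end Graph

/-! ### Column-stochastic matrices on a strongly connected support. -/

section Contraction

variable {G : Digraph V} {K : Matrix V V ℝ} {p : V → ℝ}

open Matrix

theorem sum_mulVec_of_col (hcol : ∀ j, ∑ i, K i j = 1) (u : V → ℝ) :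
    ∑ i, (K *ᵥ u) i = ∑ i, u i := by
  simp only [mulVec, dotProduct]
  rw [Finset.sum_comm]
  refine Finset.sum_congr rfl fun j _ => ?_
  rw [← Finset.sum_mul, hcol, one_mul]

/-- Since `K p = p`, the ratio `(K u)_i / p_i` is the mean of the `u_j / p_j` with weights `K i j *
p j / p i`. The left side collects the variances of these means: the gap in Jensen's inequality for
the square. -/
theorem sum_sq_div_sub (hcol : ∀ j, ∑ i, K i j = 1) (hp : ∀ i, 0 < p i) (hfix : K *ᵥ p = p)
    (u : V → ℝ) :
    ∑ i, ∑ j, K i j * p j * (u j / p j - (K *ᵥ u) i / p i) ^ 2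
      = ∑ i, u i ^ 2 / p i - ∑ i, (K *ᵥ u) i ^ 2 / p i := by
  have h1 : ∀ i, ∑ j, K i j * p j * (u j / p j - (K *ᵥ u) i / p i) ^ 2
      = ∑ j, K i j * (u j ^ 2 / p j) - (K *ᵥ u) i ^ 2 / p i := by
    intro i
    have e1 : ∑ j, K i j * u j = (K *ᵥ u) i := rfl
    have e2 : ∑ j, K i j * p j = p i := congrFun hfix i
    have hpi := (hp i).ne'
    calc _ = ∑ j, (K i j * (u j ^ 2 / p j) - 2 * ((K *ᵥ u) i / p i) * (K i j * u j)
          + ((K *ᵥ u) i / p i) ^ 2 * (K i j * p j)) := by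
          refine Finset.sum_congr rfl fun j _ => ?_
          have := (hp j).ne'
          field_simp
          ring
      _ = _ := by
          rw [Finset.sum_add_distrib, Finset.sum_sub_distrib, ← Finset.mul_sum, ← Finset.mul_sum,
            e1, e2]
          field_simp
          ring
  simp only [h1]
  rw [Finset.sum_sub_distrib, Finset.sum_comm]
  congr 1
  refine Finset.sum_congr rfl fun j _ => ?_
  rw [← Finset.sum_mul, hcol, one_mul]

/-- If nothing is lost, all variances in `sum_sq_div_sub` vanish. The positive diagonal and the
edges then make `u / p` constant along edges, hence constant, and zero sum forces `u = 0`. -/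
theorem sum_sq_div_lt (hG : StronglyConnected G) (hK : ∀ i j, 0 ≤ K i j)
    (hcol : ∀ j, ∑ i, K i j = 1) (hp : ∀ i, 0 < p i) (hfix : K *ᵥ p = p)
    (hdiag : ∀ i, 0 < K i i) (hedge : ∀ i j, G.Adj j i → 0 < K i j)
    {u : V → ℝ} (hu : ∑ i, u i = 0) (hu0 : u ≠ 0) :
    ∑ i, (K *ᵥ u) i ^ 2 / p i < ∑ i, u i ^ 2 / p i := by
  have hid := sum_sq_div_sub hcol hp hfix u
  have hnn : ∀ i j, 0 ≤ K i j * p j * (u j / p j - (K *ᵥ u) i / p i) ^ 2 := fun i j =>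
    mul_nonneg (mul_nonneg (hK i j) (hp j).le) (sq_nonneg _)
  have hnn' : ∀ i, 0 ≤ ∑ j, K i j * p j * (u j / p j - (K *ᵥ u) i / p i) ^ 2 := fun i =>
    Finset.sum_nonneg fun j _ => hnn i j
  by_contra hcon
  have hz : ∑ i, ∑ j, K i j * p j * (u j / p j - (K *ᵥ u) i / p i) ^ 2 = 0 :=
    le_antisymm (by linarith) (Finset.sum_nonneg fun i _ => hnn' i)
  have hz2 : ∀ i j, K i j * p j * (u j / p j - (K *ᵥ u) i / p i) ^ 2 = 0 := fun i j =>
    (Finset.sum_eq_zero_iff_of_nonneg fun j _ => hnn i j).1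
      ((Finset.sum_eq_zero_iff_of_nonneg fun i _ => hnn' i).1 hz i (Finset.mem_univ i)) j
      (Finset.mem_univ j)
  have heq : ∀ i j, 0 < K i j → u j / p j = (K *ᵥ u) i / p i := fun i j hij => by
    rcases mul_eq_zero.1 (hz2 i j) with h | h
    · exact absurd h (mul_pos hij (hp j)).ne'
    · exact sub_eq_zero.1 (pow_eq_zero_iff two_ne_zero |>.1 h)
  have hconst := forall_eq_of_adj hG (v := fun i => u i / p i)
    fun i j hij => (heq i j (hedge i j hij)).trans (heq i i (hdiag i)).symm
  refine hu0 (funext fun i => ?_)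
  have hup : ∀ j, u j = u i / p i * p j := fun j => by
    have h : u j / p j = u i / p i := hconst j i
    rw [← h]; have := (hp j).ne'; field_simp
  have hs : u i / p i * ∑ j, p j = 0 := by
    rw [Finset.mul_sum, ← hu]; exact Finset.sum_congr rfl fun j _ => (hup j).symm
  have hps : 0 < ∑ j, p j := Finset.sum_pos (fun j _ => hp j) ⟨i, Finset.mem_univ i⟩
  rcases mul_eq_zero.1 hs with h | h
  · rw [hup i, h]; simp
  · exact absurd h hps.ne'

/-- A column-stochastic matrix with positive fixed vector `p`, positive diagonal and strongly
connected support contracts the `1 / p`-weighted Euclidean norm of zero-sum vectors. -/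
theorem exists_contraction (hG : StronglyConnected G) (hK : ∀ i j, 0 ≤ K i j)
    (hcol : ∀ j, ∑ i, K i j = 1) (hp : ∀ i, 0 < p i) (hfix : K *ᵥ p = p)
    (hdiag : ∀ i, 0 < K i i) (hedge : ∀ i j, G.Adj j i → 0 < K i j) :
    ∃ c, 0 < c ∧ c < 1 ∧ ∀ u : V → ℝ, ∑ i, u i = 0 →
      ∑ i, (K *ᵥ u) i ^ 2 / p i ≤ c * ∑ i, u i ^ 2 / p i := by
  set S : Set (V → ℝ) := {u | ∑ i, u i = 0 ∧ ∑ i, u i ^ 2 / p i = 1} with hS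
  have hSc : IsCompact S := by
    refine (isCompact_univ_pi fun i => isCompact_Icc (a := -√(p i)) (b := √(p i))).of_isClosed_subset
      ?_ ?_
    · exact (isClosed_eq (by fun_prop) continuous_const).inter
        (isClosed_eq (by fun_prop) continuous_const)
    · rintro u ⟨-, hu⟩ i -
      have h1 : u i ^ 2 / p i ≤ 1 := by
        rw [← hu]
        exact Finset.single_le_sum (f := fun i => u i ^ 2 / p i)
          (fun j _ => div_nonneg (sq_nonneg _) (hp j).le) (Finset.mem_univ i)
      rw [div_le_one (hp i)] at h1
      exact abs_le.1 (Real.abs_le_sqrt h1)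
  have hscale : ∀ c : ℝ, (∀ u ∈ S, ∑ i, (K *ᵥ u) i ^ 2 / p i ≤ c) → ∀ u : V → ℝ, ∑ i, u i = 0 →
      ∑ i, (K *ᵥ u) i ^ 2 / p i ≤ c * ∑ i, u i ^ 2 / p i := by
    intro c hc u hu
    rcases eq_or_ne u 0 with rfl | hu0
    · simp
    have hpos : 0 < ∑ i, u i ^ 2 / p i := by
      refine (Finset.sum_nonneg fun i _ => ?_).trans_lt
        (sum_sq_div_lt hG hK hcol hp hfix hdiag hedge hu hu0)
      exact div_nonneg (sq_nonneg _) (hp i).le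
    set s := ∑ i, u i ^ 2 / p i
    have hmem : (√s)⁻¹ • u ∈ S := by
      constructor
      · simp [← Finset.mul_sum, hu]
      · simp only [Pi.smul_apply, smul_eq_mul, mul_pow, inv_pow, Real.sq_sqrt hpos.le,
          mul_div_assoc]
        rw [← Finset.mul_sum]
        exact inv_mul_cancel₀ hpos.ne'
    have h := hc _ hmem
    simp only [mulVec_smul, Pi.smul_apply, smul_eq_mul, mul_pow, inv_pow, Real.sq_sqrt hpos.le,
      mul_div_assoc] at h
    rw [← Finset.mul_sum, inv_mul_le_iff₀ hpos] at h
    linarith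
  -- The unit sphere of zero-sum vectors is empty when there are fewer than two indices.
  rcases S.eq_empty_or_nonempty with hemp | hne
  · refine ⟨1 / 2, by norm_num, by norm_num, hscale _ ?_⟩
    rw [hemp]; simp
  · obtain ⟨u₀, hu₀, hmax⟩ := hSc.exists_isMaxOn hne
      (f := fun u => ∑ i, (K *ᵥ u) i ^ 2 / p i) (by
        refine Continuous.continuousOn (continuous_finsetSum _ fun i _ => ?_)
        exact (((continuous_apply i).comp
          (continuous_const.matrix_mulVec continuous_id)).pow 2).div_const _)
    have hne0 : u₀ ≠ 0 := by
      rintro rfl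
      have := hu₀.2
      simp at this
    have hlt := sum_sq_div_lt hG hK hcol hp hfix hdiag hedge hu₀.1 hne0
    rw [hu₀.2] at hlt
    -- The maximum over the sphere may be `0`; taking the larger of it and `1 / 2` keeps the factor
    -- positive.
    refine ⟨max (1 / 2) (∑ i, (K *ᵥ u₀) i ^ 2 / p i), lt_max_of_lt_left (by norm_num),
      max_lt (by norm_num) hlt, hscale _ fun u hu => ?_⟩
    exact (hmax hu).trans (le_max_right _ _)

/-- A column-stochastic matrix with strongly connected support has a positive fixed vector. -/
theorem exists_pos_fixed [Nonempty V] (hG : StronglyConnected G) (hK : ∀ i j, 0 ≤ K i j)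
    (hcol : ∀ j, ∑ i, K i j = 1) (hedge : ∀ i j, G.Adj j i → 0 < K i j) :
    ∃ p : V → ℝ, (∀ i, 0 < p i) ∧ K *ᵥ p = p := by
  -- The all-ones row vector is a left fixed vector, so a nonzero right fixed vector `v` exists.
  have hdet : (1 - K).det = 0 := by
    refine exists_vecMul_eq_zero_iff.1 ⟨fun _ => 1, ?_, ?_⟩
    · intro h; exact one_ne_zero (congrFun h (Classical.arbitrary V))
    · ext j
      simp [vecMul, dotProduct, Finset.sum_sub_distrib, hcol, Matrix.one_apply]
  obtain ⟨v, hv0, hv⟩ := exists_mulVec_eq_zero_iff.2 hdet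
  have hvK : K *ᵥ v = v := by
    rw [sub_mulVec, one_mulVec, sub_eq_zero] at hv; exact hv.symm
  have hle : ∀ i, |v i| ≤ (K *ᵥ fun j => |v j|) i := fun i => by
    conv_lhs => rw [← hvK]
    simp only [mulVec, dotProduct]
    refine (Finset.abs_sum_le_sum_abs _ _).trans (le_of_eq (Finset.sum_congr rfl fun j _ => ?_))
    rw [abs_mul, abs_of_nonneg (hK i j)]
  -- Entrywise `|v| ≤ K |v|`, and both sides have the same sum, so equality holds. Positivity then
  -- spreads from a nonzero entry along edges.
  have hfix : K *ᵥ (fun j => |v j|) = fun j => |v j| := by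
    have h := (Finset.sum_eq_sum_iff_of_le fun i _ => hle i).1
      (sum_mulVec_of_col hcol fun j => |v j|).symm
    exact funext fun i => (h i (Finset.mem_univ i)).symm
  refine ⟨fun j => |v j|, ?_, hfix⟩
  obtain ⟨j, hj⟩ := Function.ne_iff.1 hv0
  have hj' : 0 < |v j| := abs_pos.2 hj
  intro i
  induction hG j i with
  | refl => exact hj'
  | tail _ hl ih =>
    rename_i b c _
    have h1 : K c b * |v b| ≤ ∑ l, K c l * |v l| :=
      Finset.single_le_sum (f := fun l => K c l * |v l|)
        (fun l _ => mul_nonneg (hK _ _) (abs_nonneg _)) (Finset.mem_univ b)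
    have h2 : ∑ l, K c l * |v l| = |v c| := congrFun hfix c
    rw [h2] at h1
    exact (mul_pos (hedge _ _ hl) ih).trans_le h1

end Contraction

/-! ### Weight balancing as multiplication by `P`. -/

section Weights

open Matrix

variable {G : Digraph V}

theorem matP_apply [Nontrivial V] (hG : StronglyConnected G) (i j : V) :
    matP G i j = 1 / 2 * ((1 : Matrix V V ℝ) i j + adjMatrix G i j / (outDeg G j : ℝ)) := by
  have hinv : (degMatrix G)⁻¹ = Matrix.diagonal fun i => ((outDeg G i : ℝ))⁻¹ := by
    refine Matrix.inv_eq_right_inv ?_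
    rw [degMatrix, Matrix.diagonal_mul_diagonal, ← Matrix.diagonal_one]
    congr 1
    funext i
    exact mul_inv_cancel₀ (by exact_mod_cast (outDeg_pos hG i).ne')
  rw [matP, hinv, Matrix.smul_apply, Matrix.add_apply, Matrix.mul_diagonal, smul_eq_mul]
  simp only [div_eq_mul_inv]

theorem adjMatrix_nonneg (i j : V) : 0 ≤ adjMatrix G i j := by
  classical
  simp only [adjMatrix, Matrix.of_apply]
  split_ifs <;> norm_num

theorem adjMatrix_eq_one {i j : V} (h : G.Adj j i) : adjMatrix G i j = 1 := by
  simp [adjMatrix, h]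

theorem sum_adjMatrix_mul (i : V) (g : V → ℝ) :
    ∑ j, adjMatrix G i j * g j = ∑ j ∈ inNbrs G i, g j := by
  classical
  simp [adjMatrix, inNbrs, Finset.sum_filter]

theorem sum_adjMatrix_col (j : V) : ∑ i, adjMatrix G i j = outDeg G j := by
  classical
  simp [adjMatrix, outDeg]

theorem matP_nonneg [Nontrivial V] (hG : StronglyConnected G) (i j : V) : 0 ≤ matP G i j := by
  rw [matP_apply hG]
  have := adjMatrix_nonneg (G := G) i j
  have h1 : 0 ≤ (1 : Matrix V V ℝ) i j := by rw [Matrix.one_apply]; split_ifs <;> norm_num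
  positivity

theorem matP_col [Nontrivial V] (hG : StronglyConnected G) (j : V) : ∑ i, matP G i j = 1 := by
  have h : (outDeg G j : ℝ) ≠ 0 := by exact_mod_cast (outDeg_pos hG j).ne'
  simp only [matP_apply hG]
  rw [← Finset.mul_sum, Finset.sum_add_distrib, ← Finset.sum_div, sum_adjMatrix_col, div_self h]
  simp [Matrix.one_apply]
  norm_num

theorem matP_diag [Nontrivial V] (hG : StronglyConnected G) (i : V) : 0 < matP G i i := by
  rw [matP_apply hG, Matrix.one_apply_eq]
  have := adjMatrix_nonneg (G := G) i i
  positivity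

theorem matP_edge [Nontrivial V] (hG : StronglyConnected G) (i j : V) (h : G.Adj j i) :
    0 < matP G i j := by
  rw [matP_apply hG, adjMatrix_eq_one h]
  have h1 : 0 ≤ (1 : Matrix V V ℝ) i j := by rw [Matrix.one_apply]; split_ifs <;> norm_num
  have : (0 : ℝ) < outDeg G j := by exact_mod_cast outDeg_pos hG j
  positivity

theorem matP_mulVec [Nontrivial V] (hG : StronglyConnected G) (u : V → ℝ) (i : V) :
    (matP G *ᵥ u) i = 1 / 2 * (u i + ∑ j ∈ inNbrs G i, u j / outDeg G j) := by
  simp only [mulVec, dotProduct, matP_apply hG, mul_assoc, add_mul]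
  rw [← Finset.mul_sum, Finset.sum_add_distrib, ← sum_adjMatrix_mul]
  congr 2
  · simp [Matrix.one_apply]
  · exact Finset.sum_congr rfl fun j _ => by ring

/-- In the variables `d_i w_i` weight balancing is multiplication by `P`. -/
theorem outDeg_mul_weightStep [Nontrivial V] (hG : StronglyConnected G) (w : V → ℝ) :
    (fun i => (outDeg G i : ℝ) * weightStep G w i)
      = matP G *ᵥ fun i => (outDeg G i : ℝ) * w i := by
  funext i
  have h : ∀ j, (outDeg G j : ℝ) ≠ 0 := fun j => by exact_mod_cast (outDeg_pos hG j).ne'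
  rw [matP_mulVec hG]
  have : ∀ j, (outDeg G j : ℝ) * w j / outDeg G j = w j := fun j => by
    have := h j; field_simp
  simp only [this, weightStep]
  have := h i
  field_simp

theorem outDeg_mul_iterate [Nontrivial V] (hG : StronglyConnected G) (w : V → ℝ) (t : ℕ) :
    (fun i => (outDeg G i : ℝ) * (weightStep G)^[t] w i)
      = (matP G ^ t) *ᵥ fun i => (outDeg G i : ℝ) * w i := by
  induction t with
  | zero => simp
  | succ t ih =>
    rw [Function.iterate_succ_apply', outDeg_mul_weightStep hG, ih, mulVec_mulVec, pow_succ']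

/-- Weight balancing converges geometrically to balanced weights. -/
theorem exists_balanced_limit [Nontrivial V] (hG : StronglyConnected G) {w₀ : V → ℝ}
    (hw₀ : ∀ i, 0 < w₀ i) :
    ∃ ws : V → ℝ, (∀ i, 0 < ws i) ∧ (∀ i, ∑ j ∈ inNbrs G i, ws j = (outDeg G i : ℝ) * ws i) ∧
      ∑ i, (outDeg G i : ℝ) * ws i = ∑ i, (outDeg G i : ℝ) * w₀ i ∧
      ∃ q C : ℝ, 0 < q ∧ q < 1 ∧ 0 ≤ C ∧
        ∀ t i, |(weightStep G)^[t] w₀ i - ws i| ≤ C * q ^ t := by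
  have hdpos : ∀ j, (0 : ℝ) < outDeg G j := fun j => by exact_mod_cast outDeg_pos hG j
  obtain ⟨p, hp, hfix⟩ := exists_pos_fixed hG (matP_nonneg hG) (matP_col hG) (matP_edge hG)
  obtain ⟨c, hc0, hc1, hc⟩ := exists_contraction hG (matP_nonneg hG) (matP_col hG) hp hfix
    (matP_diag hG) (matP_edge hG)
  set u₀ : V → ℝ := fun i => (outDeg G i : ℝ) * w₀ i with hu₀
  have hps : 0 < ∑ i, p i := Finset.sum_pos (fun i _ => hp i) Finset.univ_nonempty
  have hus : 0 < ∑ i, u₀ i :=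
    Finset.sum_pos (fun i _ => mul_pos (hdpos i) (hw₀ i)) Finset.univ_nonempty
  set θ := (∑ i, u₀ i) / ∑ i, p i with hθ
  have hθ0 : 0 < θ := div_pos hus hps
  have hθs : θ * ∑ i, p i = ∑ i, u₀ i := div_mul_cancel₀ _ hps.ne'
  -- The limit of `P ^ t u₀` is the multiple of `p` with the same sum, so the deviation `e` has zero
  -- sum and is contracted by `P`.
  set e : ℕ → V → ℝ := fun t => (matP G ^ t) *ᵥ u₀ - θ • p with he
  have hes : ∀ t, e (t + 1) = matP G *ᵥ e t := fun t => by
    simp only [he]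
    rw [mulVec_sub, mulVec_smul, hfix, mulVec_mulVec, pow_succ']
  have hsum : ∀ t, ∑ i, e t i = 0 := by
    intro t
    induction t with
    | zero => simp [he, Finset.sum_sub_distrib, ← Finset.mul_sum, hθs]
    | succ t ih => rw [hes, sum_mulVec_of_col (matP_col hG), ih]
  have hdecay : ∀ t, ∑ i, e t i ^ 2 / p i ≤ c ^ t * ∑ i, e 0 i ^ 2 / p i := by
    intro t
    induction t with
    | zero => simp
    | succ t ih =>
      rw [hes]
      calc _ ≤ _ := hc _ (hsum t)
        _ ≤ c * (c ^ t * ∑ i, e 0 i ^ 2 / p i) := by gcongr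
        _ = _ := by ring
  set N := ∑ i, e 0 i ^ 2 / p i with hN
  have hN0 : 0 ≤ N := Finset.sum_nonneg fun i _ => div_nonneg (sq_nonneg _) (hp i).le
  have hbound : ∀ t i, |e t i| ≤ √(p i * N) * √c ^ t := by
    intro t i
    have h1 : e t i ^ 2 / p i ≤ c ^ t * N :=
      (Finset.single_le_sum (f := fun i => e t i ^ 2 / p i)
        (fun j _ => div_nonneg (sq_nonneg _) (hp j).le) (Finset.mem_univ i)).trans (hdecay t)
    rw [div_le_iff₀ (hp i)] at h1
    have h2 : √(p i * N) * √c ^ t = √(c ^ t * N * p i) := by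
      rw [Real.sqrt_eq_rpow c, ← Real.rpow_natCast, ← Real.rpow_mul hc0.le, mul_comm (1 / 2 : ℝ),
        Real.rpow_mul hc0.le, Real.rpow_natCast, ← Real.sqrt_eq_rpow, mul_comm,
        ← Real.sqrt_mul (by positivity)]
      congr 1; ring
    rw [h2]
    exact Real.abs_le_sqrt h1
  refine ⟨fun i => θ * p i / outDeg G i, fun i => div_pos (mul_pos hθ0 (hp i)) (hdpos i), ?_, ?_,
    √c, ∑ i, √(p i * N) / outDeg G i, Real.sqrt_pos.2 hc0, ?_,
    Finset.sum_nonneg fun i _ => by positivity, ?_⟩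
  · intro i
    have h1 := congrFun hfix i
    rw [matP_mulVec hG] at h1
    have h2 : ∑ j ∈ inNbrs G i, p j / outDeg G j = p i := by linarith
    simp only [mul_div_assoc]
    rw [← Finset.mul_sum, h2]
    have := hdpos i
    field_simp
  · rw [← hθs, Finset.mul_sum]
    refine Finset.sum_congr rfl fun i _ => ?_
    have := hdpos i
    field_simp
  · rw [Real.sqrt_lt' one_pos]; simpa using hc1
  · intro t i
    have h1 : (outDeg G i : ℝ) * (weightStep G)^[t] w₀ i = ((matP G ^ t) *ᵥ u₀) i :=
      congrFun (outDeg_mul_iterate hG w₀ t) i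
    have hd := hdpos i
    have h2 : (weightStep G)^[t] w₀ i - θ * p i / outDeg G i = e t i / outDeg G i := by
      simp only [he, Pi.sub_apply, Pi.smul_apply, smul_eq_mul, ← h1]
      field_simp
    rw [h2, abs_div, abs_of_pos hd]
    calc |e t i| / outDeg G i ≤ √(p i * N) * √c ^ t / outDeg G i := by
          gcongr; exact hbound t i
      _ = √(p i * N) / outDeg G i * √c ^ t := by ring
      _ ≤ _ := by
        gcongr
        exact Finset.single_le_sum (f := fun i => √(p i * N) / (outDeg G i : ℝ))
          (fun j _ => by positivity) (Finset.mem_univ i)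

/-- The balanced limit weights satisfy `d_i w_i < 1`. -/
theorem outDeg_mul_balanced_lt_one [Nontrivial V] (hG : StronglyConnected G) {w₀ ws : V → ℝ}
    (hw₀ : ∀ i, 0 < w₀ i ∧ w₀ i ≤ ((maxOutDeg G : ℝ) ^ (2 * diam G + 1))⁻¹)
    (hw₁ : ∃ i, (outDeg G i : ℝ) * w₀ i < 1) (hws : ∀ i, 0 < ws i)
    (hbal : ∀ i, ∑ j ∈ inNbrs G i, ws j = (outDeg G i : ℝ) * ws i)
    (hsum : ∑ i, (outDeg G i : ℝ) * ws i = ∑ i, (outDeg G i : ℝ) * w₀ i) (i : V) :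
    (outDeg G i : ℝ) * ws i < 1 := by
  have hdpos : ∀ j, (0 : ℝ) < outDeg G j := fun j => by exact_mod_cast outDeg_pos hG j
  have hdle : ∀ j, (outDeg G j : ℝ) ≤ maxOutDeg G := fun j => by
    exact_mod_cast outDeg_le_maxOutDeg j
  set D : ℝ := (maxOutDeg G : ℝ) with hD
  have hD1 : 1 ≤ D := by
    have h : 1 ≤ maxOutDeg G := (outDeg_pos hG i).trans_le (outDeg_le_maxOutDeg i)
    rw [hD]; exact_mod_cast h
  have hD0 : 0 < D := by linarith
  have hedge : ∀ k l, G.Adj k l → ws k ≤ D * ws l := fun k l hkl => by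
    calc ws k ≤ ∑ j ∈ inNbrs G l, ws j :=
          Finset.single_le_sum (fun j _ => (hws j).le) (mem_inNbrs.2 hkl)
      _ = _ := hbal l
      _ ≤ _ := by have := hws l; have := hdle l; gcongr
  have hpath : ∀ t k l, Within G t k l → ws k ≤ D ^ t * ws l := by
    intro t
    induction t with
    | zero => rintro k l rfl; simp
    | succ t ih =>
      rintro k l ⟨r, hr, hrl⟩
      refine (ih k r hr).trans ?_
      rw [pow_succ, mul_assoc]
      have h : ws r ≤ D * ws l := by
        rcases hrl with rfl | h
        · have := hws r; nlinarith
        · exact hedge r l h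
      gcongr
  -- Balance bounds the ratio of two weights by `D` along each edge, hence by `D ^ diam G` overall.
  -- Comparing `ws i` with all nodes and using conservation of `∑ d_j w_j` bounds it by the initial
  -- weights.
  have hratio : ∀ j, ws i ≤ D ^ diam G * ws j := fun j => hpath _ i j (within_diam hG i j)
  have hφ := diam_pos hG
  set φ := diam G
  have hds : 0 < ∑ j, (outDeg G j : ℝ) :=
    Finset.sum_pos (fun j _ => hdpos j) Finset.univ_nonempty
  have h1 : ws i * ∑ j, (outDeg G j : ℝ) ≤ D ^ φ * ∑ j, (outDeg G j : ℝ) * w₀ j := by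
    rw [← hsum, Finset.mul_sum, Finset.mul_sum]
    refine Finset.sum_le_sum fun j _ => ?_
    have := hratio j
    have := hdpos j
    calc ws i * outDeg G j ≤ D ^ φ * ws j * outDeg G j := by gcongr
      _ = _ := by ring
  have h2 : ∑ j, (outDeg G j : ℝ) * w₀ j ≤ (D ^ (2 * φ + 1))⁻¹ * ∑ j, (outDeg G j : ℝ) := by
    rw [Finset.mul_sum]
    refine Finset.sum_le_sum fun j _ => ?_
    rw [mul_comm]
    have := hdpos j
    gcongr
    exact (hw₀ j).2
  -- If `D = 1` all out-degrees are `1` and the power of `D` gives nothing: `ws i` is at most the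
  -- mean of the `w₀ j ≤ 1`, one of which is below `1`. If `D > 1` one gets `d_i ws_i ≤ D ^ (-φ) <
  -- 1`.
  rcases hD1.eq_or_lt with h | h
  · obtain ⟨k, hk⟩ := hw₁
    have hd1 : ∀ j, (outDeg G j : ℝ) = 1 := fun j => by
      refine le_antisymm (h ▸ hdle j) ?_
      exact_mod_cast outDeg_pos hG j
    simp only [hd1, ← h, one_pow, one_mul, inv_one] at *
    have h3 : ∑ j, w₀ j < ∑ _j : V, (1 : ℝ) :=
      Finset.sum_lt_sum (fun j _ => (hw₀ j).2) ⟨k, Finset.mem_univ k, hk⟩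
    by_contra hcon
    have : ∑ _j : V, (1 : ℝ) ≤ ws i * ∑ _j : V, (1 : ℝ) := le_mul_of_one_le_left hds.le (not_lt.1 hcon)
    linarith
  · have h3 : ws i ≤ D ^ φ * (D ^ (2 * φ + 1))⁻¹ := by
      refine le_of_mul_le_mul_right ?_ hds
      calc _ ≤ _ := h1
        _ ≤ D ^ φ * ((D ^ (2 * φ + 1))⁻¹ * ∑ j, (outDeg G j : ℝ)) := by gcongr
        _ = _ := by ring
    calc (outDeg G i : ℝ) * ws i ≤ D * (D ^ φ * (D ^ (2 * φ + 1))⁻¹) := by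
          have := hdle i; have := hws i; gcongr
      _ = (D ^ φ)⁻¹ := by
          rw [show 2 * φ + 1 = φ + φ + 1 by ring, pow_succ, pow_add]
          field_simp
      _ < 1 := inv_lt_one_of_one_lt₀ (one_lt_pow₀ h hφ.ne')

/-- If a product of `K - z` over a multiset of numbers of modulus less than `s` annihilates `v`,
then `K ^ t v = O(s ^ t)`. -/
theorem norm_pow_mulVec_le (K : Matrix V V ℂ) {s : ℝ} (hs : 0 < s) (R : Multiset ℂ)
    (hR : ∀ z ∈ R, ‖z‖ < s) (v : V → ℂ)
    (hv : Polynomial.aeval K (R.map fun z => Polynomial.X - Polynomial.C z).prod *ᵥ v = 0) :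
    ∃ C, 0 ≤ C ∧ ∀ t, ‖(K ^ t) *ᵥ v‖ ≤ C * s ^ t := by
  induction R using Multiset.induction_on generalizing v with
  | empty =>
    have hv' : v = 0 := by simpa using hv
    exact ⟨0, le_rfl, by simp [hv']⟩
  | cons z R ih =>
    rw [Multiset.map_cons, Multiset.prod_cons, mul_comm, map_mul, ← mulVec_mulVec] at hv
    obtain ⟨C, hC, hb⟩ := ih (fun y hy => hR y (Multiset.mem_cons_of_mem hy)) _ hv
    have hstep : ∀ t, ‖(K ^ (t + 1)) *ᵥ v‖ ≤ ‖z‖ * ‖(K ^ t) *ᵥ v‖ + C * s ^ t := by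
      intro t
      -- Peeling off `K - z` gives a recursion with factor `‖z‖ < s` and forcing `O(s ^ t)`. No
      -- diagonalizability is needed, since the strict inequality absorbs the polynomial factors of
      -- Jordan blocks.
      have e : (K ^ (t + 1)) *ᵥ v = z • ((K ^ t) *ᵥ v) + (K ^ t) *ᵥ
          (Polynomial.aeval K (Polynomial.X - Polynomial.C z) *ᵥ v) := by
        rw [map_sub, Polynomial.aeval_X, Polynomial.aeval_C, sub_mulVec, mulVec_sub,
          Algebra.algebraMap_eq_smul_one, smul_mulVec, one_mulVec, mulVec_smul, mulVec_mulVec,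
          pow_succ]
        abel
      rw [e]
      refine (norm_add_le _ _).trans ?_
      rw [norm_smul]
      gcongr
      exact hb t
    obtain ⟨C', hC', h⟩ := recursion_bound (V := fun t => ‖(K ^ t) *ᵥ v‖) (norm_nonneg z) hs hs.le hC
      (Or.inl ⟨hR z (Multiset.mem_cons_self z R), le_rfl⟩) 0 (fun _ => norm_nonneg _)
      (fun t _ => hstep t)
    exact ⟨C', hC', fun t => h t (Nat.zero_le t)⟩

/-- This is Cayley–Hamilton with one factor `X - 1` split off: the range of `K - 1` is annihilated
by the remaining factors, so only the erased multiset governs its decay. -/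
theorem aeval_erase_roots_mul (K : Matrix V V ℂ) [DecidableEq ℂ] :
    Polynomial.aeval K ((K.charpoly.roots.erase 1).map fun z => Polynomial.X - Polynomial.C z).prod
      * (K - 1) = 0 := by
  have hsplit : K.charpoly = (K.charpoly.roots.map fun z => Polynomial.X - Polynomial.C z).prod :=
    (IsAlgClosed.splits K.charpoly).eq_prod_roots_of_monic K.charpoly_monic
  have h0 := Matrix.aeval_self_charpoly K
  by_cases h1 : (1 : ℂ) ∈ K.charpoly.roots
  · rw [hsplit, ← Multiset.cons_erase h1, Multiset.map_cons, Multiset.prod_cons, mul_comm,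
      map_mul] at h0
    simpa using h0
  · rw [Multiset.erase_of_notMem h1, ← hsplit, h0, zero_mul]

/-- The increments of the weights decay at every rate above `λ₂(P)`. -/
theorem weight_increment_le [Nontrivial V] (hG : StronglyConnected G) (w₀ : V → ℝ) {s : ℝ}
    (hs : lambda2 G < s) :
    ∃ C, 0 ≤ C ∧ ∀ t i, |(weightStep G)^[t + 1] w₀ i - (weightStep G)^[t] w₀ i| ≤ C * s ^ t := by
  classical
  have hdpos : ∀ j, (0 : ℝ) < outDeg G j := fun j => by exact_mod_cast outDeg_pos hG j
  have hs0 : 0 < s := (NNReal.coe_nonneg _).trans_lt hs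
  set K : Matrix V V ℂ := (matP G).map (fun r : ℝ => (r : ℂ)) with hK
  set u₀ : V → ℝ := fun i => (outDeg G i : ℝ) * w₀ i with hu₀
  set u : V → ℂ := fun i => (u₀ i : ℂ) with hu
  have hR : ∀ z ∈ K.charpoly.roots.erase 1, ‖z‖ < s := by
    intro z hz
    refine lt_of_le_of_lt ?_ hs
    have h : ‖z‖₊ ≤ ((K.charpoly.roots.erase 1).map fun z => ‖z‖₊).sup :=
      Multiset.le_sup (Multiset.mem_map_of_mem _ hz)
    rw [lambda2, ← coe_nnnorm, NNReal.coe_le_coe]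
    convert h
  obtain ⟨C, hC, hb⟩ := norm_pow_mulVec_le K hs0 _ hR ((K - 1) *ᵥ u) (by
    rw [mulVec_mulVec, aeval_erase_roots_mul, zero_mulVec])
  have hpow : ∀ t i, ((K ^ t) *ᵥ u) i = (((matP G ^ t) *ᵥ u₀) i : ℝ) := by
    intro t i
    have e : K ^ t = (matP G ^ t).map (fun r : ℝ => (r : ℂ)) := by
      have := (map_pow (Complex.ofRealHom.mapMatrix (m := V)) (matP G) t).symm
      exact this
    rw [e]
    simp [mulVec, dotProduct, hu]
  refine ⟨∑ i, C / outDeg G i, Finset.sum_nonneg fun i _ => by positivity, fun t i => ?_⟩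
  have h1 : ∀ t, (outDeg G i : ℝ) * (weightStep G)^[t] w₀ i = ((matP G ^ t) *ᵥ u₀) i := fun t =>
    congrFun (outDeg_mul_iterate hG w₀ t) i
  have hd := hdpos i
  have h2 : (weightStep G)^[t + 1] w₀ i - (weightStep G)^[t] w₀ i
      = (((matP G ^ (t + 1)) *ᵥ u₀) i - ((matP G ^ t) *ᵥ u₀) i) / outDeg G i := by
    rw [← h1, ← h1]; field_simp
  have h3 : |((matP G ^ (t + 1)) *ᵥ u₀) i - ((matP G ^ t) *ᵥ u₀) i| ≤ C * s ^ t := by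
    have h4 := (norm_le_pi_norm _ i).trans (hb t)
    rw [mulVec_mulVec, mul_sub, mul_one, ← pow_succ, sub_mulVec, Pi.sub_apply, hpow, hpow,
      ← Complex.ofReal_sub, Complex.norm_real] at h4
    exact h4
  rw [h2, abs_div, abs_of_pos hd]
  calc _ ≤ C * s ^ t / outDeg G i := by gcongr
    _ = C / outDeg G i * s ^ t := by ring
    _ ≤ _ := by
      gcongr
      exact Finset.single_le_sum (f := fun i => C / (outDeg G i : ℝ))
        (fun j _ => by positivity) (Finset.mem_univ i)

end Weights

/-! ### The averaging matrices and existence of a contraction factor. -/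

section Averaging

open Matrix

variable {G : Digraph V}

theorem sum_avgStep {F : Type*} [NormedAddCommGroup F] [InnerProductSpace ℝ F] (w : V → ℝ)
    (ξ : V → F) : ∑ i, avgStep G w ξ i = ∑ i, ξ i := by
  simp only [avgStep, sub_smul, one_smul]
  rw [Finset.sum_add_distrib, Finset.sum_sub_distrib, sum_sum_inNbrs fun j => w j • ξ j]
  simp [smul_smul]

theorem avgStep_eq_mulVec (w v : V → ℝ) :
    avgStep G w v = (diagonal (fun i => 1 - (outDeg G i : ℝ) * w i)
      + adjMatrix G * diagonal w) *ᵥ v := by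
  funext i
  rw [add_mulVec, Pi.add_apply, mulVec_diagonal, ← mulVec_mulVec]
  simp only [avgStep, smul_eq_mul]
  congr 1
  rw [← sum_adjMatrix_mul]
  simp [mulVec, dotProduct, diagonal_apply]

/-- The averaging matrix `K` of the balanced limit weights is doubly stochastic, so
`exists_contraction` applies with `p = 1` and gives the factor `√c`. The matrix in round `t` differs
from `K` by `O(q ^ t)`, so the midpoint of `√c` and `1` works eventually. -/
theorem exists_contractionFactor [Nontrivial V] (hG : StronglyConnected G) {w₀ : V → ℝ}
    (hw₀ : ∀ i, 0 < w₀ i ∧ w₀ i ≤ ((maxOutDeg G : ℝ) ^ (2 * diam G + 1))⁻¹)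
    (hw₁ : ∃ i, (outDeg G i : ℝ) * w₀ i < 1) : ∃ δ, IsContractionFactor G w₀ δ := by
  obtain ⟨ws, hws, hbal, hsum, q, C, hq0, hq1, hC, hconv⟩ :=
    exists_balanced_limit hG fun i => (hw₀ i).1
  have hlt := outDeg_mul_balanced_lt_one hG hw₀ hw₁ hws hbal hsum
  set K : Matrix V V ℝ := diagonal (fun i => 1 - (outDeg G i : ℝ) * ws i)
      + adjMatrix G * diagonal ws with hKdef
  have hKapp : ∀ i j, K i j = (if i = j then 1 - (outDeg G i : ℝ) * ws i else 0)
      + adjMatrix G i j * ws j := fun i j => by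
    rw [hKdef, Matrix.add_apply, diagonal_apply, mul_diagonal]
  have hK : ∀ i j, 0 ≤ K i j := fun i j => by
    rw [hKapp]
    have := mul_nonneg (adjMatrix_nonneg (G := G) i j) (hws j).le
    split_ifs
    · linarith [hlt i]
    · linarith
  have hcol : ∀ j, ∑ i, K i j = 1 := fun j => by
    simp only [hKapp]
    rw [Finset.sum_add_distrib, ← Finset.sum_mul, sum_adjMatrix_col]
    simp
  have hfix : K *ᵥ (fun _ => 1) = fun _ => 1 := by
    rw [hKdef, ← avgStep_eq_mulVec]
    funext i
    simp [avgStep, hbal]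
  have hdiag : ∀ i, 0 < K i i := fun i => by
    rw [hKapp, if_pos rfl]
    have := mul_nonneg (adjMatrix_nonneg (G := G) i i) (hws i).le
    linarith [hlt i]
  have hedge : ∀ i j, G.Adj j i → 0 < K i j := fun i j h => by
    rw [hKapp, adjMatrix_eq_one h, one_mul]
    have := hws j
    split_ifs
    · linarith [hlt i]
    · linarith
  obtain ⟨c, hc0, hc1, hc⟩ := exists_contraction hG hK hcol (fun _ => one_pos) hfix hdiag hedge
  simp only [div_one] at hc
  have hsc1 : √c < 1 := by rw [Real.sqrt_lt' one_pos]; simpa using hc1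
  have hsc0 : 0 < √c := Real.sqrt_pos.2 hc0
  set n : ℝ := (Fintype.card V : ℝ)
  refine ⟨(√c + 1) / 2, by linarith, by linarith, ?_⟩
  have hlim : Filter.Tendsto (fun t : ℕ => n * (2 * n) * (C * q ^ t)) Filter.atTop (𝓝 0) := by
    have := (tendsto_pow_atTop_nhds_zero_of_lt_one hq0.le hq1).const_mul (n * (2 * n) * C)
    rw [mul_zero] at this
    exact this.congr fun t => by ring
  obtain ⟨t₀, ht₀⟩ := Filter.eventually_atTop.1
    (hlim.eventually_lt_const (show 0 < (1 - √c) / 2 by linarith))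
  refine ⟨t₀, fun t ht v hv => ?_⟩
  have hsmall := (ht₀ t ht).le
  set w := (weightStep G)^[t] w₀
  set ε := C * q ^ t
  have hε : 0 ≤ ε := by positivity
  have hnorm : ∀ x : V → ℝ, √(∑ i, x i ^ 2) = ‖WithLp.toLp 2 x‖ := fun x => by
    rw [EuclideanSpace.norm_eq]; simp
  set Nv := √(∑ i, v i ^ 2) with hNv
  have hvi : ∀ i, |v i| ≤ Nv := fun i => Real.abs_le_sqrt
    (Finset.single_le_sum (f := fun i => v i ^ 2) (fun j _ => sq_nonneg _) (Finset.mem_univ i))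
  have hNv0 : 0 ≤ Nv := Real.sqrt_nonneg _
  set r : V → ℝ := fun i => avgStep G w v i - (K *ᵥ v) i with hr
  have hri : ∀ i, |r i| ≤ 2 * n * ε * Nv := by
    intro i
    have e : r i = -((outDeg G i : ℝ) * (w i - ws i) * v i)
        + ∑ j ∈ inNbrs G i, (w j - ws j) * v j := by
      have e1 : (K *ᵥ v) i = avgStep G ws v i := by rw [avgStep_eq_mulVec]
      rw [hr]
      simp only [e1, avgStep, smul_eq_mul, sub_mul, Finset.sum_sub_distrib]
      ring
    have hterm : ∀ j, |(w j - ws j) * v j| ≤ ε * Nv := fun j => by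
      rw [abs_mul]
      exact mul_le_mul (hconv t j) (hvi j) (abs_nonneg _) hε
    have hdn : (outDeg G i : ℝ) ≤ n := Nat.cast_le.2 (outDeg_le_card i)
    have hin : ((inNbrs G i).card : ℝ) ≤ n := Nat.cast_le.2 (Finset.card_le_univ _)
    rw [e]
    refine (abs_add_le _ _).trans ?_
    have h1 : |-((outDeg G i : ℝ) * (w i - ws i) * v i)| ≤ n * (ε * Nv) := by
      rw [abs_neg, mul_assoc, abs_mul, Nat.abs_cast]
      exact mul_le_mul hdn (hterm i) (abs_nonneg _) (by positivity)
    have h2 : |∑ j ∈ inNbrs G i, (w j - ws j) * v j| ≤ n * (ε * Nv) := by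
      refine (Finset.abs_sum_le_sum_abs _ _).trans ?_
      refine (Finset.sum_le_card_nsmul _ _ _ fun j _ => hterm j).trans ?_
      rw [nsmul_eq_mul]
      have := mul_nonneg hε hNv0
      gcongr
    linarith
  have hrn : √(∑ i, r i ^ 2) ≤ n * (2 * n) * ε * Nv := by
    have h1 : √(∑ i, r i ^ 2) ≤ ∑ i, |r i| := by
      rw [Real.sqrt_le_left (Finset.sum_nonneg fun i _ => abs_nonneg _)]
      simp only [← sq_abs (r _)]
      exact Finset.sum_sq_le_sq_sum_of_nonneg fun i _ => abs_nonneg _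
    refine h1.trans ((Finset.sum_le_card_nsmul _ _ _ fun i _ => hri i).trans (le_of_eq ?_))
    rw [nsmul_eq_mul, Finset.card_univ]
    ring
  have hKn : √(∑ i, (K *ᵥ v) i ^ 2) ≤ √c * Nv := by
    rw [hNv, ← Real.sqrt_mul hc0.le]
    exact Real.sqrt_le_sqrt (hc v hv)
  have htri : √(∑ i, avgStep G w v i ^ 2) ≤ √(∑ i, (K *ᵥ v) i ^ 2) + √(∑ i, r i ^ 2) := by
    rw [hnorm, hnorm, hnorm]
    have e : WithLp.toLp 2 (avgStep G w v) = WithLp.toLp 2 (K *ᵥ v) + WithLp.toLp 2 r := by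
      rw [← WithLp.toLp_add]; congr 1; funext i; simp [hr]
    rw [e]
    exact norm_add_le _ _
  calc _ ≤ √c * Nv + n * (2 * n) * ε * Nv := htri.trans (add_le_add hKn hrn)
    _ = (√c + n * (2 * n) * ε) * Nv := by ring
    _ ≤ _ := by gcongr; linarith

end Averaging

/-! ### Splitting stacked vectors into consensus and zero-sum parts. -/

section Mean

variable {E : Type*} [NormedAddCommGroup E] [InnerProductSpace ℝ E]

/-- The average of a family of vectors. -/
def mean (ξ : V → E) : E := (Fintype.card V : ℝ)⁻¹ • ∑ i, ξ i

theorem card_smul_mean [Nonempty V] (ξ : V → E) : (Fintype.card V : ℝ) • mean ξ = ∑ i, ξ i := by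
  rw [mean, smul_smul, mul_inv_cancel₀ (by simp), one_smul]

theorem sum_sub_mean [Nonempty V] (ξ : V → E) : ∑ i, (ξ i - mean ξ) = 0 := by
  rw [Finset.sum_sub_distrib, Finset.sum_const, Finset.card_univ, ← Nat.cast_smul_eq_nsmul ℝ,
    card_smul_mean, sub_self]

theorem inner_toLp_const {v : V → E} (hv : ∑ i, v i = 0) (c : E) :
    inner ℝ (WithLp.toLp 2 v : PiLp 2 fun _ : V => E) (WithLp.toLp 2 fun _ => c) = 0 := by
  simp only [PiLp.inner_apply]
  rw [← sum_inner, hv, inner_zero_left]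

theorem norm_sq_toLp (v : V → E) :
    ‖(WithLp.toLp 2 v : PiLp 2 fun _ : V => E)‖ ^ 2 = ∑ i, ‖v i‖ ^ 2 := by
  rw [PiLp.norm_sq_eq_of_L2]

theorem norm_sq_toLp_add_const {v : V → E} (hv : ∑ i, v i = 0) (c : E) :
    ‖(WithLp.toLp 2 fun i => v i + c : PiLp 2 fun _ : V => E)‖ ^ 2
      = ‖(WithLp.toLp 2 v : PiLp 2 fun _ : V => E)‖ ^ 2 + Fintype.card V * ‖c‖ ^ 2 := by
  have e : (WithLp.toLp 2 fun i => v i + c : PiLp 2 fun _ : V => E)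
      = WithLp.toLp 2 v + WithLp.toLp 2 fun _ => c := rfl
  rw [e, norm_add_sq_real, inner_toLp_const hv, norm_sq_toLp fun _ : V => c]
  simp

theorem norm_toLp_le_sum (v : V → E) :
    ‖(WithLp.toLp 2 v : PiLp 2 fun _ : V => E)‖ ≤ ∑ i, ‖v i‖ := by
  refine le_of_sq_le_sq ?_ (Finset.sum_nonneg fun i _ => norm_nonneg _)
  rw [norm_sq_toLp]
  exact Finset.sum_sq_le_sq_sum_of_nonneg fun i _ => norm_nonneg _

end Mean

/-! ### Error of `B` averaging rounds with unbalanced weights. -/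

section InnerLoop

variable {G : Digraph V}

theorem innerStep_iterate_fst {F : Type*} [NormedAddCommGroup F] [InnerProductSpace ℝ F]
    (w : V → ℝ) (ξ : V → F) (b : ℕ) :
    ((innerStep G)^[b] (w, ξ)).1 = (weightStep G)^[b] w := by
  induction b with
  | zero => rfl
  | succ b ih => rw [Function.iterate_succ_apply', Function.iterate_succ_apply', ← ih]; rfl

theorem innerStep_iterate_succ_snd {F : Type*} [NormedAddCommGroup F] [InnerProductSpace ℝ F]
    (w : V → ℝ) (ξ : V → F) (b : ℕ) :
    ((innerStep G)^[b + 1] (w, ξ)).2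
      = avgStep G ((weightStep G)^[b] w) ((innerStep G)^[b] (w, ξ)).2 := by
  rw [Function.iterate_succ_apply', ← innerStep_iterate_fst w ξ b]; rfl

theorem sum_innerStep_iterate {F : Type*} [NormedAddCommGroup F] [InnerProductSpace ℝ F]
    (w : V → ℝ) (ξ : V → F) (b : ℕ) : ∑ i, ((innerStep G)^[b] (w, ξ)).2 i = ∑ i, ξ i := by
  induction b with
  | zero => rfl
  | succ b ih => rw [innerStep_iterate_succ_snd, sum_avgStep, ih]

/-- Averaging acts on a consensus vector as the identity up to the increment of the weights. -/
theorem avgStep_sub_const [Nontrivial V] (hG : StronglyConnected G)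
    {F : Type*} [NormedAddCommGroup F] [InnerProductSpace ℝ F]
    (w : V → ℝ) (ξ : V → F) (c : F) (i : V) :
    avgStep G w ξ i - c = avgStep G w (fun i => ξ i - c) i
      + (2 * (outDeg G i : ℝ) * (weightStep G w i - w i)) • c := by
  have hd : (outDeg G i : ℝ) ≠ 0 := by exact_mod_cast (outDeg_pos hG i).ne'
  -- The imbalance, in-weight minus out-weight at `i`, is `2 d_i` times the weight increment.
  have e : 2 * (outDeg G i : ℝ) * (weightStep G w i - w i)
      = ∑ j ∈ inNbrs G i, w j - outDeg G i * w i := by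
    simp only [weightStep]; field_simp; ring
  rw [e]
  simp only [avgStep, smul_sub, Finset.sum_sub_distrib, ← Finset.sum_smul]
  module

variable {d : ℕ}

/-- Averaging acts on each coordinate separately, so the scalar contraction factor carries over to
vector-valued families. -/
theorem norm_avgStep_le {w : V → ℝ} {δ : ℝ} (hδ : 0 ≤ δ)
    (h : ∀ v : V → ℝ, ∑ i, v i = 0 →
      √(∑ i, avgStep G w v i ^ 2) ≤ δ * √(∑ i, v i ^ 2))
    (v : V → EuclideanSpace ℝ (Fin d)) (hv : ∑ i, v i = 0) :
    ‖(WithLp.toLp 2 (avgStep G w v) : PiLp 2 fun _ : V => EuclideanSpace ℝ (Fin d))‖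
      ≤ δ * ‖(WithLp.toLp 2 v : PiLp 2 fun _ : V => EuclideanSpace ℝ (Fin d))‖ := by
  refine le_of_sq_le_sq ?_ (by positivity)
  rw [mul_pow, norm_sq_toLp, norm_sq_toLp]
  simp only [EuclideanSpace.norm_sq_eq, Real.norm_eq_abs, sq_abs]
  rw [Finset.sum_comm, Finset.sum_comm (f := fun i c => v i c ^ 2), Finset.mul_sum]
  refine Finset.sum_le_sum fun c _ => ?_
  have hc : ∀ i, avgStep G w v i c = avgStep G w (fun j => v j c) i := fun i => by
    simp [avgStep]
  have hvc : ∑ i, v i c = 0 := by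
    have := congrArg (fun x : EuclideanSpace ℝ (Fin d) => x c) hv
    simpa using this
  have h1 := h (fun j => v j c) hvc
  have h2 := pow_le_pow_left₀ (Real.sqrt_nonneg _) h1 2
  rw [mul_pow, Real.sq_sqrt (Finset.sum_nonneg fun i _ => sq_nonneg _),
    Real.sq_sqrt (Finset.sum_nonneg fun i _ => sq_nonneg _)] at h2
  simpa only [hc] using h2

/-- The inner loop contracts the disagreement by `δ ^ b`, up to an error from the imbalance of
the weights. -/
theorem norm_innerStep_iterate_le [Nontrivial V] (hG : StronglyConnected G) {w : V → ℝ} {δ ε : ℝ}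
    (hδ : 0 ≤ δ) (hδ1 : δ ≤ 1) (hε : 0 ≤ ε)
    (h : ∀ b, ∀ v : V → ℝ, ∑ i, v i = 0 →
      √(∑ i, avgStep G ((weightStep G)^[b] w) v i ^ 2) ≤ δ * √(∑ i, v i ^ 2))
    (hw : ∀ b i, |(weightStep G)^[b + 1] w i - (weightStep G)^[b] w i| ≤ ε)
    (ξ : V → EuclideanSpace ℝ (Fin d)) (b : ℕ) :
    ‖(WithLp.toLp 2 fun i => ((innerStep G)^[b] (w, ξ)).2 i - mean ξ :
        PiLp 2 fun _ : V => EuclideanSpace ℝ (Fin d))‖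
      ≤ δ ^ b * ‖(WithLp.toLp 2 fun i => ξ i - mean ξ :
          PiLp 2 fun _ : V => EuclideanSpace ℝ (Fin d))‖
        + b * (2 * (Fintype.card V : ℝ) ^ 2 * ε) * ‖mean ξ‖ := by
  induction b with
  | zero => simp
  | succ b ih =>
    set ξb := ((innerStep G)^[b] (w, ξ)).2 with hξb
    set c := mean ξ
    set wb := (weightStep G)^[b] w with hwb
    set n : ℝ := (Fintype.card V : ℝ)
    have e : (WithLp.toLp 2 fun i => ((innerStep G)^[b + 1] (w, ξ)).2 i - c :
        PiLp 2 fun _ : V => EuclideanSpace ℝ (Fin d))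
        = WithLp.toLp 2 (avgStep G wb fun i => ξb i - c)
          + WithLp.toLp 2 fun i => (2 * (outDeg G i : ℝ) * (weightStep G wb i - wb i)) • c := by
      rw [← WithLp.toLp_add]
      congr 1
      funext i
      rw [innerStep_iterate_succ_snd, avgStep_sub_const hG]
      rfl
    have hsum : ∑ i, (ξb i - c) = 0 := by
      rw [Finset.sum_sub_distrib, hξb, sum_innerStep_iterate, ← Finset.sum_sub_distrib]
      exact sum_sub_mean ξ
    have h1 := norm_avgStep_le hδ (h b) (fun i => ξb i - c) hsum
    have h2 : ‖(WithLp.toLp 2 fun i =>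
        (2 * (outDeg G i : ℝ) * (weightStep G wb i - wb i)) • c :
        PiLp 2 fun _ : V => EuclideanSpace ℝ (Fin d))‖ ≤ (2 * n ^ 2 * ε) * ‖c‖ := by
      refine (norm_toLp_le_sum _).trans ?_
      have h3 : ∀ i ∈ (Finset.univ : Finset V),
          ‖(2 * (outDeg G i : ℝ) * (weightStep G wb i - wb i)) • c‖ ≤ 2 * n * ε * ‖c‖ := by
        intro i _
        rw [norm_smul, Real.norm_eq_abs, abs_mul, abs_mul, Nat.abs_cast, abs_two]
        have h4 := hw b i
        rw [Function.iterate_succ_apply'] at h4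
        have h5 : (outDeg G i : ℝ) ≤ n := Nat.cast_le.2 (outDeg_le_card i)
        gcongr
      refine (Finset.sum_le_card_nsmul _ _ _ h3).trans (le_of_eq ?_)
      rw [nsmul_eq_mul, Finset.card_univ]
      ring
    rw [e]
    have hn0 : 0 ≤ n := Nat.cast_nonneg _
    have hN : 0 ≤ (b : ℝ) * (2 * n ^ 2 * ε) * ‖c‖ := by positivity
    calc _ ≤ _ := norm_add_le _ _
      _ ≤ δ * (δ ^ b * ‖(WithLp.toLp 2 fun i => ξ i - c :
            PiLp 2 fun _ : V => EuclideanSpace ℝ (Fin d))‖ + b * (2 * n ^ 2 * ε) * ‖c‖)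
          + (2 * n ^ 2 * ε) * ‖c‖ := by
          refine add_le_add (h1.trans ?_) h2
          gcongr
      _ ≤ _ := by
          rw [pow_succ δ]
          push_cast
          nlinarith [mul_le_mul_of_nonneg_right hδ1 hN]

end InnerLoop

/-- This is `(x + y)² ≤ x² / δ + y² / (1 - δ)` with `x = δ ^ B a`; the division by `δ` is the origin
of the exponent `2B - 1`. -/
theorem sq_add_le_young {δ : ℝ} (hδ : 0 < δ) (hδ1 : δ < 1) {B : ℕ} (hB : 1 ≤ B) (a b : ℝ) :
    (δ ^ B * a + b) ^ 2 ≤ δ ^ (2 * B - 1) * a ^ 2 + b ^ 2 / (1 - δ) := by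
  obtain ⟨k, rfl⟩ : ∃ k, B = k + 1 := ⟨B - 1, by omega⟩
  have e : 2 * (k + 1) - 1 = 2 * k + 1 := by omega
  have h1 : 0 < 1 - δ := by linarith
  have key : δ ^ (2 * k + 1) * a ^ 2 + b ^ 2 / (1 - δ) - (δ ^ (k + 1) * a + b) ^ 2
      = δ * ((1 - δ) * δ ^ k * a - b) ^ 2 / (1 - δ) := by
    field_simp
    ring
  have : 0 ≤ δ * ((1 - δ) * δ ^ k * a - b) ^ 2 / (1 - δ) := by positivity
  rw [e]
  linarith

/-- The averaging error is a `δ ^ (2B - 1)` fraction of the primal error plus a vanishing term. -/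
theorem norm_sq_averaging_error_le [Nonempty V] {E : Type*} [NormedAddCommGroup E]
    [InnerProductSpace ℝ E]
    {δ e : ℝ} (hδ : 0 < δ) (hδ1 : δ < 1) {B : ℕ} (hB : 1 ≤ B)
    (ξ : V → E) (c : E) {r : ℝ} (hr0 : 0 ≤ r)
    (hr : r ≤ δ ^ B * ‖(WithLp.toLp 2 fun i => ξ i - mean ξ : PiLp 2 fun _ : V => E)‖
      + e * ‖mean ξ‖)
    (hsmall : 2 * e ^ 2 / (1 - δ) ≤ δ ^ (2 * B - 1)) :
    r ^ 2 ≤ δ ^ (2 * B - 1) * ‖(WithLp.toLp 2 fun i => ξ i - c : PiLp 2 fun _ : V => E)‖ ^ 2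
      + 2 * e ^ 2 / (1 - δ) * ‖c‖ ^ 2 := by
  have h1 : 0 < 1 - δ := by linarith
  have h2 : r ^ 2 ≤ _ := pow_le_pow_left₀ hr0 hr 2
  have h3 := h2.trans (sq_add_le_young hδ hδ1 hB _ _)
  -- By Pythagoras the disagreement is charged `‖ξ - mean ξ‖²` only. The consensus part `n ‖mean ξ -
  -- c‖²` of the primal error stays free to absorb the part of the imbalance error that does not
  -- vanish by itself.
  have h4 := norm_sq_toLp_add_const (sum_sub_mean ξ) (mean ξ - c)
  have e4 : (fun i => ξ i - mean ξ + (mean ξ - c)) = fun i => ξ i - c := by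
    funext i; abel
  rw [e4] at h4
  have h5 : ‖mean ξ‖ ^ 2 ≤ 2 * ‖mean ξ - c‖ ^ 2 + 2 * ‖c‖ ^ 2 := by
    have h := norm_add_le (mean ξ - c) c
    rw [sub_add_cancel] at h
    have h' := pow_le_pow_left₀ (norm_nonneg _) h 2
    nlinarith [sq_nonneg (‖mean ξ - c‖ - ‖c‖)]
  have hn : (1 : ℝ) ≤ Fintype.card V := by exact_mod_cast Fintype.card_pos (α := V)
  have h6 : (e * ‖mean ξ‖) ^ 2 / (1 - δ)
      ≤ 2 * e ^ 2 / (1 - δ) * ‖mean ξ - c‖ ^ 2 + 2 * e ^ 2 / (1 - δ) * ‖c‖ ^ 2 := by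
    calc _ = e ^ 2 / (1 - δ) * ‖mean ξ‖ ^ 2 := by ring
      _ ≤ e ^ 2 / (1 - δ) * (2 * ‖mean ξ - c‖ ^ 2 + 2 * ‖c‖ ^ 2) := by gcongr
      _ = _ := by ring
  have h7 : 2 * e ^ 2 / (1 - δ) * ‖mean ξ - c‖ ^ 2
      ≤ δ ^ (2 * B - 1) * (Fintype.card V * ‖mean ξ - c‖ ^ 2) := by
    have : ‖mean ξ - c‖ ^ 2 ≤ Fintype.card V * ‖mean ξ - c‖ ^ 2 :=
      le_mul_of_one_le_left (sq_nonneg _) hn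
    gcongr
  rw [h4]
  linarith

/-- Fermat's rule for `∑ f_i` at the common block. With `sum_iterate_y` it makes the dual error
orthogonal to consensus vectors, as `descent` requires. -/
theorem sum_dual_optimal_eq_zero {E : Type*} [NormedAddCommGroup E] [InnerProductSpace ℝ E]
    [CompleteSpace E] [Nonempty V] {f : V → E → ℝ} (hf : ∀ i, Differentiable ℝ (f i))
    {xs ys : V → E} (h : IsPrimalDualOptimal f xs ys) : ∑ i, ys i = 0 := by
  obtain ⟨hc, hmin, hys⟩ := h
  set xh := xs (Classical.arbitrary V)
  have hx : ∀ i, xs i = xh := fun i => hc _ _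
  simp only [hx] at hmin hys
  have hF : HasFDerivAt (fun u => ∑ i, f i u)
      (∑ i, InnerProductSpace.toDual ℝ E (gradient (f i) xh)) xh :=
    HasFDerivAt.fun_sum fun i _ => ((hf i) xh).hasGradientAt.hasFDerivAt
  have h0 := IsLocalMin.hasFDerivAt_eq_zero (Filter.Eventually.of_forall hmin) hF
  rw [← map_sum, map_eq_zero_iff _ (InnerProductSpace.toDual ℝ E).injective] at h0
  have h1 : ∑ i, (gradient (f i) xh + ys i) = 0 := Finset.sum_eq_zero fun i _ => hys i
  rwa [Finset.sum_add_distrib, h0, zero_add] at h1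

/-! ### Invariants of the generated sequence. -/

section Iterates

variable {G : Digraph V} {E : Type*} [NormedAddCommGroup E] [InnerProductSpace ℝ E]
  [CompleteSpace E]

theorem iterate_w (f : V → E → ℝ) (η ρ : ℝ) (B : ℕ) (w₀ : V → ℝ) (k : ℕ) :
    (iterate G f η ρ B w₀ k).w = (weightStep G)^[k * B] w₀ := by
  induction k with
  | zero => simp [iterate]
  | succ k ih =>
    rw [Nat.succ_mul, add_comm (k * B), Function.iterate_add_apply, ← ih]
    exact innerStep_iterate_fst _ _ _

theorem sum_iterate_z (f : V → E → ℝ) (η ρ : ℝ) (B : ℕ) (w₀ : V → ℝ) (k : ℕ) :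
    ∑ i, (iterate G f η ρ B w₀ k).z i = ∑ i, (iterate G f η ρ B w₀ k).x i := by
  cases k with
  | zero => rfl
  | succ k => exact sum_innerStep_iterate _ _ _

theorem sum_iterate_y (f : V → E → ℝ) (η ρ : ℝ) (B : ℕ) (w₀ : V → ℝ) (k : ℕ) :
    ∑ i, (iterate G f η ρ B w₀ k).y i = 0 := by
  induction k with
  | zero => simp [iterate]
  | succ k ih =>
    have h := sum_iterate_z (G := G) f η ρ B w₀ (k + 1)
    have e : ∀ i, (iterate G f η ρ B w₀ (k + 1)).y i = (iterate G f η ρ B w₀ k).y i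
        + ρ • ((iterate G f η ρ B w₀ (k + 1)).x i - (iterate G f η ρ B w₀ (k + 1)).z i) :=
      fun i => rfl
    simp only [e]
    rw [Finset.sum_add_distrib, ih, ← Finset.smul_sum, Finset.sum_sub_distrib, h]
    simp

end Iterates

/-! ### The perturbed recursion satisfied by IPD. -/

section Convergence

variable {G : Digraph V} {d : ℕ}

/-- From some iteration on, the averaging error of IPD is a `δ ^ (2B - 1)` fraction of the primal
error plus a term decaying with the weight increments. -/
theorem exists_averaging_error_bound [Nontrivial V] (hG : StronglyConnected G) {w₀ : V → ℝ}
    {δ : ℝ} (hδ : IsContractionFactor G w₀ δ) {s C : ℝ} (hs0 : 0 < s) (hs1 : s < 1) (hC : 0 ≤ C)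
    (hinc : ∀ t i, |(weightStep G)^[t + 1] w₀ i - (weightStep G)^[t] w₀ i| ≤ C * s ^ t)
    {B : ℕ} (hB : 1 ≤ B) (f : V → EuclideanSpace ℝ (Fin d) → ℝ) (η ρ : ℝ)
    (c : EuclideanSpace ℝ (Fin d)) :
    ∃ K T, 0 ≤ T ∧ ∀ k ≥ K,
      ‖(WithLp.toLp 2 fun i => (iterate G f η ρ B w₀ (k + 1)).z i
          - mean (iterate G f η ρ B w₀ (k + 1)).x :
          PiLp 2 fun _ : V => EuclideanSpace ℝ (Fin d))‖ ^ 2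
        ≤ δ ^ (2 * B - 1) * ‖(WithLp.toLp 2 fun i => (iterate G f η ρ B w₀ (k + 1)).x i - c :
          PiLp 2 fun _ : V => EuclideanSpace ℝ (Fin d))‖ ^ 2 + T * (s ^ 2) ^ k := by
  obtain ⟨hδ0, hδ1, t₀, ht₀⟩ := hδ
  have h1δ : 0 < 1 - δ := by linarith
  set n : ℝ := (Fintype.card V : ℝ)
  set A : ℝ := B * (2 * n ^ 2 * C) with hA
  have hs2 : s ^ 2 < 1 := by nlinarith
  have hlim : Filter.Tendsto (fun k : ℕ => 2 * (A * s ^ k) ^ 2 / (1 - δ)) Filter.atTop (𝓝 0) := by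
    have := (tendsto_pow_atTop_nhds_zero_of_lt_one (sq_nonneg s) hs2).const_mul
      (2 * A ^ 2 / (1 - δ))
    rw [mul_zero] at this
    refine this.congr fun k => ?_
    rw [← pow_mul, mul_comm 2 k, pow_mul]
    ring
  obtain ⟨K₁, hK₁⟩ := Filter.eventually_atTop.1
    (hlim.eventually_lt_const (pow_pos hδ0 (2 * B - 1)))
  refine ⟨max t₀ K₁, 2 * A ^ 2 / (1 - δ) * ‖c‖ ^ 2, by positivity, fun k hk => ?_⟩
  have hkt : t₀ ≤ k * B := ((le_max_left _ _).trans hk).trans (Nat.le_mul_of_pos_right k hB)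
  have hsmall := (hK₁ k ((le_max_right _ _).trans hk)).le
  set S := iterate G f η ρ B w₀ k with hS
  have hSw : S.w = (weightStep G)^[k * B] w₀ := iterate_w f η ρ B w₀ k
  have hz : (iterate G f η ρ B w₀ (k + 1)).z
      = ((innerStep G)^[B] (S.w, (iterate G f η ρ B w₀ (k + 1)).x)).2 := rfl
  set x := (iterate G f η ρ B w₀ (k + 1)).x
  have hwb : ∀ b, (weightStep G)^[b] S.w = (weightStep G)^[k * B + b] w₀ := fun b => by
    rw [hSw, ← Function.iterate_add_apply, add_comm]
  have hr := norm_innerStep_iterate_le hG (w := S.w) (ε := C * s ^ k) hδ0.le hδ1.le (by positivity)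
    (fun b v hv => by
      rw [hwb]
      exact ht₀ _ (by omega) v hv)
    (fun b i => by
      rw [hwb, hwb, ← add_assoc]
      refine (hinc _ i).trans ?_
      gcongr ?_ * ?_
      -- Round `b` of iteration `k` has global index `k B + b ≥ k` because `B ≥ 1`, so `s ^ k`
      -- bounds all increments of the iteration.
      exact pow_le_pow_of_le_one hs0.le hs1.le
        ((Nat.le_mul_of_pos_right k hB).trans (Nat.le_add_right _ _)))
    x B
  rw [hz]
  have hr' := norm_sq_averaging_error_le hδ0 hδ1 hB (e := A * s ^ k) x c (norm_nonneg _)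
    (hr.trans (le_of_eq (by rw [hA]; ring))) hsmall
  refine hr'.trans (le_of_eq ?_)
  rw [← pow_mul, mul_comm 2 k, pow_mul]
  ring

/-- The Lyapunov function of IPD decreases up to the averaging errors. -/
theorem exists_lyapunov_bound [Nontrivial V] {w₀ : V → ℝ}
    {f : V → EuclideanSpace ℝ (Fin d) → ℝ} {m M η ρ δ : ℝ} {B : ℕ}
    (h : Admissible m M η ρ δ B)
    (hf : ∀ i, Differentiable ℝ (f i))
    (hmono : ∀ i u v, m * ‖u - v‖ ^ 2 ≤ inner ℝ (gradient (f i) u - gradient (f i) v) (u - v))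
    (hlip : ∀ i u v, ‖gradient (f i) u - gradient (f i) v‖ ≤ M * ‖u - v‖)
    {xs ys : V → EuclideanSpace ℝ (Fin d)} (hopt : IsPrimalDualOptimal f xs ys) {p T : ℝ}
    (hp : 0 ≤ p) (hT : 0 ≤ T) {K : ℕ} {c : EuclideanSpace ℝ (Fin d)} (hxs : ∀ i, xs i = c)
    (hR : ∀ k ≥ K, ‖(WithLp.toLp 2 fun i => (iterate G f η ρ B w₀ (k + 1)).z i
          - mean (iterate G f η ρ B w₀ (k + 1)).x :
          PiLp 2 fun _ : V => EuclideanSpace ℝ (Fin d))‖ ^ 2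
        ≤ δ ^ (2 * B - 1) * ‖(WithLp.toLp 2 fun i => (iterate G f η ρ B w₀ (k + 1)).x i - c :
          PiLp 2 fun _ : V => EuclideanSpace ℝ (Fin d))‖ ^ 2 + T * p ^ k) :
    ∃ C, 0 ≤ C ∧ ∀ k ≥ K,
      c₂ m M η ρ δ B * ∑ i, ‖(iterate G f η ρ B w₀ (k + 2)).x i - xs i‖ ^ 2
        + 1 / (2 * ρ) * ∑ i, ‖(iterate G f η ρ B w₀ (k + 2)).y i - ys i‖ ^ 2 ≤
      (if c₁ m M η ρ δ B < c₂ m M η ρ δ B then μ₁ m M η ρ δ B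
        else c₁ m M η ρ δ B / c₂ m M η ρ δ B)
        * (c₂ m M η ρ δ B * ∑ i, ‖(iterate G f η ρ B w₀ (k + 1)).x i - xs i‖ ^ 2
          + 1 / (2 * ρ) * ∑ i, ‖(iterate G f η ρ B w₀ (k + 1)).y i - ys i‖ ^ 2) + C * p ^ k := by
  have hys := sum_dual_optimal_eq_zero hf hopt
  obtain ⟨-, -, hgrad⟩ := hopt
  obtain ⟨C, hC, hstep⟩ := lyapunov_step (H := PiLp 2 fun _ : V => EuclideanSpace ℝ (Fin d)) h
  -- The errors before and after the step are `T p ^ k` and `T p ^ (k + 1)`.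
  refine ⟨C * (T + T * p), by positivity, fun k hk => ?_⟩
  simp only [hxs] at hgrad ⊢
  set S := iterate G f η ρ B w₀ (k + 1) with hS
  set S' := iterate G f η ρ B w₀ (k + 2) with hS'
  have hx' : ∀ i, S'.x i = S.x i - η • (gradient (f i) (S.x i) + S.y i + ρ • (S.x i - S.z i)) :=
    fun i => rfl
  have hy' : ∀ i, S'.y i = S.y i + ρ • (S'.x i - S'.z i) := fun i => rfl
  have hsa := sum_sub_mean S.x
  have hsa' := sum_sub_mean S'.x
  have hsR : ∑ i, (S.z i - mean S.x) = 0 := by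
    rw [Finset.sum_sub_distrib, hS, sum_iterate_z, ← Finset.sum_sub_distrib, ← hS]
    exact hsa
  have hsY : ∑ i, (S.y i - ys i) = 0 := by
    rw [Finset.sum_sub_distrib, hS, sum_iterate_y, hys, sub_zero]
  set P : (V → EuclideanSpace ℝ (Fin d)) → PiLp 2 fun _ : V => EuclideanSpace ℝ (Fin d) :=
    WithLp.toLp 2
  have hstep' := hstep
    (X := P fun i => S.x i - c) (X' := P fun i => S'.x i - c)
    (Y := P fun i => S.y i - ys i) (Y' := P fun i => S'.y i - ys i)
    (g := P fun i => gradient (f i) (S.x i) - gradient (f i) c)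
    (a := P fun i => S.x i - mean S.x) (a' := P fun i => S'.x i - mean S'.x)
    (b' := P fun _ => mean S'.x - c)
    (R := P fun i => S.z i - mean S.x) (R' := P fun i => S'.z i - mean S'.x)
    (θ := T * p ^ k) (θ' := T * p ^ (k + 1)) (by positivity) (by positivity)
    (by
      ext1 i
      change S'.x i - c = (S.x i - c) - η • ((gradient (f i) (S.x i) - gradient (f i) c)
        + (S.y i - ys i) + ρ • ((S.x i - mean S.x) - (S.z i - mean S.x)))
      -- Optimality lets `∇f_i(c) + y⋆_i = 0` be subtracted inside the update; the mean of `x`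
      -- cancels from `x - z`.
      have e : ys i = -gradient (f i) c := (neg_eq_of_add_eq_zero_right (hgrad i)).symm
      rw [hx', e]
      module)
    (by
      ext1 i
      change S'.y i - ys i = (S.y i - ys i)
        + ρ • ((S'.x i - mean S'.x) - (S'.z i - mean S'.x))
      rw [hy']
      module)
    (by
      ext1 i
      change S'.x i - c = (S'.x i - mean S'.x) + (mean S'.x - c)
      abel)
    (inner_toLp_const hsY _) (inner_toLp_const hsa _) (inner_toLp_const hsR _)
    (by
      refine le_of_sq_le_sq ?_ (norm_nonneg _)
      have hs : ∑ i, ((S'.x i - mean S'.x) - (S.x i - mean S.x)) = 0 := by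
        rw [Finset.sum_sub_distrib, hsa, hsa', sub_zero]
      have e := norm_sq_toLp_add_const hs (mean S'.x - mean S.x)
      have e1 : (P fun i => S'.x i - c) - (P fun i => S.x i - c)
          = WithLp.toLp 2 fun i => (S'.x i - mean S'.x) - (S.x i - mean S.x)
            + (mean S'.x - mean S.x) := by
        ext1 i
        change (S'.x i - c) - (S.x i - c) = (S'.x i - mean S'.x) - (S.x i - mean S.x)
            + (mean S'.x - mean S.x)
        abel
      rw [e1, e]
      exact le_add_of_nonneg_right (by positivity))
    (by
      refine le_of_sq_le_sq ?_ (norm_nonneg _)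
      have e := norm_sq_toLp_add_const hsa (mean S.x - c)
      have e1 : (P fun i => S.x i - c)
          = WithLp.toLp 2 fun i => (S.x i - mean S.x) + (mean S.x - c) := by
        ext1 i
        change S.x i - c = (S.x i - mean S.x) + (mean S.x - c)
        abel
      rw [e1, e]
      exact le_add_of_nonneg_right (by positivity))
    (by
      rw [norm_sq_toLp, norm_sq_toLp, PiLp.inner_apply, Finset.mul_sum, Finset.mul_sum,
        ← Finset.sum_add_distrib]
      exact Finset.sum_le_sum fun i _ => inner_gradient_sub_ge h.m_pos h.M_pos
        (fun x => (hf i x).hasGradientAt) (hmono i) (hlip i) (S.x i) c)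
    (hR k hk) (hR (k + 1) (hk.trans (Nat.le_succ k)))
  simp only [P, norm_sq_toLp] at hstep'
  refine hstep'.trans (le_of_eq ?_)
  ring

end Convergence

end IPD

end

theorem theorem1 {V : Type*} [Fintype V] [DecidableEq V] [Nontrivial V]
    (G : Digraph V) (hG : IPD.StronglyConnected G)
    (w₀ : V → ℝ)
    (hw₀ : ∀ i, 0 < w₀ i ∧ w₀ i ≤ ((IPD.maxOutDeg G : ℝ) ^ (2 * IPD.diam G + 1))⁻¹)
    (hw₁ : ∃ i, (IPD.outDeg G i : ℝ) * w₀ i < 1) :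
    (∃ δ, IPD.IsContractionFactor G w₀ δ) ∧
    ∀ δ, IPD.IsContractionFactor G w₀ δ →
      ∀ (d : ℕ) (f : V → EuclideanSpace ℝ (Fin d) → ℝ) (m M : ℝ),
        0 < m → 0 < M →
        (∀ i, Differentiable ℝ (f i)) →
        (∀ i u v, m * ‖u - v‖ ^ 2 ≤ inner ℝ (gradient (f i) u - gradient (f i) v) (u - v)) →
        (∀ i u v, ‖gradient (f i) u - gradient (f i) v‖ ≤ M * ‖u - v‖) →
        ∀ xs ys : V → EuclideanSpace ℝ (Fin d), IPD.IsPrimalDualOptimal f xs ys →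
        ∀ (η ρ : ℝ) (B : ℕ),
          0 < η → η ≤ 4 / (15 * (M + m)) →
          0 < ρ → ρ < 4 / 87 * (M * m / (M + m)) →
          IPD.minRounds m M δ ≤ (B : ℝ) →
          (fun k : ℕ =>
              ∑ i, ‖(IPD.iterate G f η ρ B w₀ k).x i - xs i‖ ^ 2
                + ∑ i, ‖(IPD.iterate G f η ρ B w₀ k).y i - ys i‖ ^ 2)
            =O[Filter.atTop] fun k : ℕ => IPD.rate G m M η ρ δ B ^ k := by
  open IPD in
  refine ⟨exists_contractionFactor hG hw₀ hw₁, ?_⟩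
  intro δ hδ d f m M hm hM hf hmono hlip xs ys hopt η ρ B hη hη' hρ hρ' hB
  obtain ⟨hB1, hBpow⟩ := pow_le_of_minRounds hδ.1 hδ.2.1 hB
  have h : Admissible m M η ρ δ B := ⟨hm, hM, hη, hη', hρ, hρ', hδ.1, hδ.2.1, hB1, hBpow⟩
  set r := rate G m M η ρ δ B with hr
  set μ := if c₁ m M η ρ δ B < c₂ m M η ρ δ B then μ₁ m M η ρ δ B
        else c₁ m M η ρ δ B / c₂ m M η ρ δ B with hμ
  have hμ₁ := h.μ₁_pos
  have hrμ : 2 * μ₁ m M η ρ δ B / (1 + μ₁ m M η ρ δ B) ≤ r := le_max_left _ _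
  have hrl : lambda2 G ≤ r := le_max_right _ _
  have hr0 : 0 < r := lt_of_lt_of_le (by positivity) hrμ
  have hμ0 : 0 ≤ μ := by
    have := h.c₁_pos
    have := h.c₂_pos
    rw [hμ]; split_ifs <;> positivity
  obtain ⟨s, C, hs0, hs1, hC, hinc, hcmp⟩ : ∃ s C : ℝ, 0 < s ∧ s < 1 ∧ 0 ≤ C ∧
      (∀ t i, |(weightStep G)^[t + 1] w₀ i - (weightStep G)^[t] w₀ i| ≤ C * s ^ t) ∧
      ((μ < r ∧ s ^ 2 ≤ r) ∨ (μ ≤ r ∧ s ^ 2 < r)) := by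
    -- Below `1`, `s = √r` strictly exceeds `λ₂(P)` and `s² = r`, while `μ₁ < r` is strict. At `r ≥
    -- 1` any geometric decay of the increments suffices, and `μ` is only known to satisfy `μ ≤ r`.
    rcases lt_or_ge r 1 with hr1 | hr1
    · have hsq : r < √r := by
        rw [Real.lt_sqrt hr0.le]; nlinarith
      obtain ⟨C, hC, hinc⟩ := weight_increment_le hG w₀ (hrl.trans_lt hsq)
      refine ⟨√r, C, Real.sqrt_pos.2 hr0, ?_, hC, hinc, Or.inl ⟨?_, ?_⟩⟩
      · rw [Real.sqrt_lt' one_pos]; simpa using hr1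
      · have hc : c₁ m M η ρ δ B < c₂ m M η ρ δ B := by
          by_contra hc
          linarith [(h.c₁_div_c₂_le (not_lt.1 hc)).1]
        rw [hμ, if_pos hc]
        exact (h.μ₁_lt_of_lt_one (h.μ₁_lt_one hc)).trans_le hrμ
      · rw [Real.sq_sqrt hr0.le]
    · obtain ⟨ws, -, -, -, q, C, hq0, hq1, hC, hconv⟩ :=
        exists_balanced_limit hG fun i => (hw₀ i).1
      refine ⟨q, 2 * C, hq0, hq1, by positivity, fun t i => ?_, Or.inr ⟨?_, by nlinarith⟩⟩
      · have h1 := hconv (t + 1) i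
        have h2 := hconv t i
        have h3 : C * q ^ (t + 1) ≤ C * q ^ t := by
          gcongr ?_ * ?_
          exact pow_le_pow_of_le_one hq0.le hq1.le (Nat.le_succ t)
        rw [abs_le] at h1 h2 ⊢
        constructor <;> linarith [h1.1, h1.2, h2.1, h2.2]
      · rw [hμ]
        split_ifs with hc
        · exact (h.μ₁_lt_one hc).le.trans hr1
        · exact (h.c₁_div_c₂_le (not_lt.1 hc)).2.trans hrμ
  have hxs : ∀ i, xs i = xs (Classical.arbitrary V) := fun i => hopt.1 _ _
  obtain ⟨K, T, hT, hR⟩ := exists_averaging_error_bound hG hδ hs0 hs1 hC hinc hB1 f η ρ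
    (xs (Classical.arbitrary V))
  obtain ⟨C', hC', hV⟩ := exists_lyapunov_bound h hf hmono hlip hopt (sq_nonneg s) hT hxs hR
  have hc₂ := h.c₂_pos
  obtain ⟨D, hD, hbound⟩ := recursion_bound
    (V := fun k => c₂ m M η ρ δ B * ∑ i, ‖(iterate G f η ρ B w₀ (k + 1)).x i - xs i‖ ^ 2
        + 1 / (2 * ρ) * ∑ i, ‖(iterate G f η ρ B w₀ (k + 1)).y i - ys i‖ ^ 2)
    hμ0 hr0 (sq_nonneg s) hC' hcmp K (fun k => by positivity) hV
  -- The factor `1 / c₂ + 2ρ` undoes the weights of the Lyapunov function, and `D / r` accounts for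
  -- the index shift `k + 1`.
  refine Asymptotics.IsBigO.of_bound ((1 / c₂ m M η ρ δ B + 2 * ρ) * (D / r)) ?_
  filter_upwards [Filter.eventually_ge_atTop (K + 1)] with k hk
  obtain ⟨k, rfl⟩ : ∃ j, k = j + 1 := ⟨k - 1, by omega⟩
  have hb := hbound k (by omega)
  rw [Real.norm_of_nonneg (by positivity), Real.norm_of_nonneg (by positivity)]
  have hX : 0 ≤ ∑ i, ‖(iterate G f η ρ B w₀ (k + 1)).x i - xs i‖ ^ 2 := by positivity
  have hY : 0 ≤ ∑ i, ‖(iterate G f η ρ B w₀ (k + 1)).y i - ys i‖ ^ 2 := by positivity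
  generalize ∑ i, ‖(iterate G f η ρ B w₀ (k + 1)).x i - xs i‖ ^ 2 = X at *
  generalize ∑ i, ‖(iterate G f η ρ B w₀ (k + 1)).y i - ys i‖ ^ 2 = Y at *
  generalize c₂ m M η ρ δ B = b at *
  calc X + Y ≤ X + Y + (1 / b * (1 / (2 * ρ) * Y) + 2 * ρ * (b * X)) :=
        le_add_of_nonneg_right (by positivity)
    _ = (1 / b + 2 * ρ) * (b * X + 1 / (2 * ρ) * Y) := by field_simp; ring
    _ ≤ (1 / b + 2 * ρ) * (D * r ^ k) := by gcongr
    _ = (1 / b + 2 * ρ) * (D / r) * r ^ (k + 1) := by rw [pow_succ]; field_simp
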